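/- Let $\mathcal M$ be a compact smooth $n$-dimensional manifold with boundary ($n\ge 1$), and let $f:\mathcal M\to[0,1]$ be a smooth Morse function on it regarded as a cobordism from $V_0=f^{-1}(0)$ to $V_1=f^{-1}(1)$: $\partial\mathcal M=V_0\sqcup V_1$, and all critical points of $f$ lie in the interior of $\mathcal M$ and have invertible Hessian. Let $h$ be a smooth Riemannian metric on $\mathcal M$ and $\zeta>1$ a real constant, and let $$g_{\mu\nu}=(h^{\rho\lambda}\partial_\rho f\,\partial_\lambda f)\,h_{\mu\nu}-\zeta\,\partial_\mu f\,\partial_\nu f$$ be the associated Morse metric, time-oriented so that $f$ increases towards the future. The Morse geometry $(M,g)$ is the spacetime on $M=\mathcal M\setminus\{\text{critical points of }f\}$. For a spacetime $U$ with (possibly empty) spacelike initial and final boundary $\partial U$, write $I^{\pm}(x)$ for the chronological future and past of $x$ in $U$, defined by timelike curves lying in $U$. For $S\subseteq U$ let the common past $\downarrow S$ be the interior in $U$ of $\{q\in U: q\ll s\ \forall s\in S\}$, and define the common future $\uparrow S$ dually. The spacetime $U$ is called causally continuous if $I^-(x)=\downarrow I^+(x)$ and $I^+(x)=\uparrow I^-(x)$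 for every $x\in U\setminus\partial U$. An elementary decomposition of $\mathcal M$ consists of regular values $0=a_0<a_1<\dots<a_r=1$ of $f$ such that each elementary cobordism $\mathcal E_k=f^{-1}([a_{k-1},a_k])$, $k=1,\dots,r$, contains exactly one critical point $p_k$; the corresponding elementary Morse geometries are $(E_k,g)$ with $E_k=\mathcal E_k\setminus\{p_k\}$, whose boundary is $f^{-1}(\{a_{k-1},a_k\})$. Suppose that $f$ has only one critical point per critical value, i.e. distinct critical points of $f$ have distinct critical values. Then, if $f$ has at least one critical point, an elementary decomposition of $\mathcal M$ exists; and for every elementary decomposition, $(M,g)$ is causally continuous if and only if each of the elementary Morse geometries $(E_1,g),\dots,(E_r,g)$ is causally continuous. -/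

import Mathlib

open Set Topology Manifold ContDiff

noncomputable section

namespace MorseGeometry

/-- The Euclidean space on which an `n`-dimensional manifold with boundary is modelled. -/
abbrev Model (n : ℕ) : Type := EuclideanSpace ℝ (Fin n)

section Definitions

variable {n : ℕ} [NeZero n] {M : Type*} [TopologicalSpace M]
  [ChartedSpace (EuclideanHalfSpace n) M] [IsManifold (𝓡∂ n) ∞ M]

/-- The differential `df` at `x`, as a covector. -/
def differential (f : M → ℝ) (x : M) : TangentSpace (𝓡∂ n) x →L[ℝ] ℝ :=
  mfderiv (𝓡∂ n) 𝓘(ℝ, ℝ) f x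

/-- The critical points of `f`: the points where `df = 0`. -/
def criticalSet (n : ℕ) [NeZero n] {M : Type*} [TopologicalSpace M]
    [ChartedSpace (EuclideanHalfSpace n) M] (f : M → ℝ) : Set M :=
  {x | mfderiv (𝓡∂ n) 𝓘(ℝ, ℝ) f x = 0}

/-- The Hessian `∂_μ ∂_ν f` of `f` at (an interior point) `x`, in the preferred chart at `x`. -/
def hessian (n : ℕ) [NeZero n] {M : Type*} [TopologicalSpace M]
    [ChartedSpace (EuclideanHalfSpace n) M] (f : M → ℝ) (x : M) :
    Model n →L[ℝ] Model n →L[ℝ] ℝ :=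
  fderiv ℝ (fderiv ℝ (f ∘ (extChartAt (𝓡∂ n) x).symm)) (extChartAt (𝓡∂ n) x x)

/-- `f` is a Morse function on the cobordism `M` from `V₀ = f⁻¹(0)` to `V₁ = f⁻¹(1)`:
it is smooth with values in `[0, 1]`, the boundary of `M` is the (disjoint) union of `f⁻¹(0)`
and `f⁻¹(1)`, and the critical points lie in the interior of `M` and are nondegenerate. -/
structure IsMorseFunction (n : ℕ) [NeZero n] {M : Type*} [TopologicalSpace M]
    [ChartedSpace (EuclideanHalfSpace n) M] (f : M → ℝ) : Prop where
  smooth : ContMDiff (𝓡∂ n) 𝓘(ℝ, ℝ) ∞ f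
  mem_Icc : ∀ x, f x ∈ Icc (0 : ℝ) 1
  boundary_eq : (𝓡∂ n).boundary M = f ⁻¹' {0} ∪ f ⁻¹' {1}
  critical_interior : ∀ p ∈ criticalSet n f, (𝓡∂ n).IsInteriorPoint p
  nondegenerate : ∀ p ∈ criticalSet n f, ∀ v : Model n,
    (∀ w : Model n, hessian n f p v w = 0) → v = 0

/-- A smooth Riemannian metric on `M`. -/
abbrev RiemannianMetric (n : ℕ) [NeZero n] (M : Type*) [TopologicalSpace M]
    [ChartedSpace (EuclideanHalfSpace n) M] [IsManifold (𝓡∂ n) ∞ M] :=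
  Bundle.ContMDiffRiemannianMetric (𝓡∂ n) ∞ (Model n) (fun x : M => TangentSpace (𝓡∂ n) x)

/-- The gradient `ξ^μ = h^{μν} ∂_ν f`, obtained from `df` by the inverse of
`v ↦ h(v, ·)`, which is invertible by positive definiteness (see `inner_gradient`). -/
def gradient (h : RiemannianMetric n M) (f : M → ℝ) (x : M) : TangentSpace (𝓡∂ n) x :=
  (h.inner x).inverse (differential f x)

theorem inner_gradient (h : RiemannianMetric n M) (f : M → ℝ) (x : M)
    (v : TangentSpace (𝓡∂ n) x) :
    h.inner x (gradient h f x) v = differential f x v := by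
  let T := TangentSpace (𝓡∂ n) x
  have hfin : FiniteDimensional ℝ T := inferInstanceAs (FiniteDimensional ℝ (Model n))
  have hT2 : T2Space T := inferInstanceAs (T2Space (Model n))
  let B : T →ₗ[ℝ] (T →L[ℝ] ℝ) := (h.inner x).toLinearMap
  have hinj : Function.Injective B := by
    refine (injective_iff_map_eq_zero B).2 fun u hu => ?_
    by_contra hne
    have h1 := h.pos x u hne
    have h2 : h.inner x u = 0 := hu
    rw [h2] at h1
    simp at h1
  have hdim : Module.finrank ℝ T = Module.finrank ℝ (T →L[ℝ] ℝ) := by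
    rw [← (LinearMap.toContinuousLinearMap : (T →ₗ[ℝ] ℝ) ≃ₗ[ℝ] (T →L[ℝ] ℝ)).finrank_eq]
    exact (Subspace.dual_finrank_eq (K := ℝ) (V := T)).symm
  let e : T ≃L[ℝ] (T →L[ℝ] ℝ) :=
    (LinearEquiv.ofInjectiveOfFinrankEq B hinj hdim).toContinuousLinearEquiv
  have he : (h.inner x) = (e : T →L[ℝ] (T →L[ℝ] ℝ)) := by
    ext u w
    rfl
  have hg : gradient h f x = e.symm (differential f x) := by
    unfold gradient
    rw [he, ContinuousLinearMap.inverse_equiv]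
    rfl
  rw [hg, he]
  exact congrArg (fun L : T →L[ℝ] ℝ => L v) (e.apply_symm_apply (differential f x))

/-- The Morse metric
`g_{μν} = (h^{ρλ} ∂_ρ f ∂_λ f) h_{μν} - ζ ∂_μ f ∂_ν f`. -/
def morseMetric (h : RiemannianMetric n M) (f : M → ℝ) (ζ : ℝ) (x : M)
    (v w : TangentSpace (𝓡∂ n) x) : ℝ :=
  differential f x (gradient h f x) * h.inner x v w - ζ * (differential f x v * differential f x w)

/-- `v` is timelike and future-directed, the time orientation being the one in which the
gradient of `f` is future-directed, i.e. in which `f` increases towards the future. -/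
def IsFutureTimelike (h : RiemannianMetric n M) (f : M → ℝ) (ζ : ℝ) (x : M)
    (v : TangentSpace (𝓡∂ n) x) : Prop :=
  morseMetric h f ζ x v v < 0 ∧ 0 < differential f x v

/-- `γ`, restricted to `[0, 1]`, is a differentiable future-directed timelike curve lying in `U`
(with one-sided derivatives at the two end points). -/
def IsTimelikeCurve (h : RiemannianMetric n M) (f : M → ℝ) (ζ : ℝ) (U : Set M) (γ : ℝ → M) :
    Prop :=
  ∀ t ∈ Icc (0 : ℝ) 1, γ t ∈ U ∧
    MDifferentiableWithinAt 𝓘(ℝ, ℝ) (𝓡∂ n) γ (Icc 0 1) t ∧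
    IsFutureTimelike h f ζ (γ t)
      (mfderivWithin 𝓘(ℝ, ℝ) (𝓡∂ n) γ (Icc 0 1) t (1 : ℝ))

/-- The chronological relation `x ≪ y` of the spacetime `(U, g|_U)`: `x` and `y` are joined
by a (piecewise) differentiable future-directed timelike curve in `U`. -/
def Chron (h : RiemannianMetric n M) (f : M → ℝ) (ζ : ℝ) (U : Set M) : M → M → Prop :=
  Relation.TransGen fun x y => ∃ γ : ℝ → M, IsTimelikeCurve h f ζ U γ ∧ γ 0 = x ∧ γ 1 = y

/-- The chronological future `I⁺(x, U)`. -/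
def chronFuture (h : RiemannianMetric n M) (f : M → ℝ) (ζ : ℝ) (U : Set M) (x : M) : Set M :=
  {y | Chron h f ζ U x y}

/-- The chronological past `I⁻(x, U)`. -/
def chronPast (h : RiemannianMetric n M) (f : M → ℝ) (ζ : ℝ) (U : Set M) (x : M) : Set M :=
  {y | Chron h f ζ U y x}

/-- The interior of `A` in the subspace `U`. -/
def relInterior (U A : Set M) : Set M := {q | q ∈ U ∧ A ∈ 𝓝[U] q}

/-- The common past of `S` in the spacetime `U`: the interior (in `U`) of the set of points
which precede every point of `S`. -/
def commonPast (h : RiemannianMetric n M) (f : M → ℝ) (ζ : ℝ) (U S : Set M) : Set M :=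
  relInterior U {q | q ∈ U ∧ ∀ s ∈ S, Chron h f ζ U q s}

/-- The common future of `S` in the spacetime `U`. -/
def commonFuture (h : RiemannianMetric n M) (f : M → ℝ) (ζ : ℝ) (U S : Set M) : Set M :=
  relInterior U {q | q ∈ U ∧ ∀ s ∈ S, Chron h f ζ U s q}

/-- The points of `U` off the boundary of the spacetime `U`; for the regions used here (`M`
without the critical points, and slabs of `M` between regular levels of `f`) the boundary
consists of the points of `∂M` in `U` and of the bounding level surfaces. -/
def spacetimeInterior (n : ℕ) [NeZero n] {M : Type*} [TopologicalSpace M]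
    [ChartedSpace (EuclideanHalfSpace n) M] (U : Set M) : Set M :=
  interior U ∩ (𝓡∂ n).interior M

/-- The spacetime `(U, g|_U)` is causally continuous: `I⁻(x)` is the common past of `I⁺(x)` and
`I⁺(x)` is the common future of `I⁻(x)` for every point `x` off the boundary of `U`. -/
def CausallyContinuous (h : RiemannianMetric n M) (f : M → ℝ) (ζ : ℝ) (U : Set M) : Prop :=
  ∀ x ∈ spacetimeInterior n U,
    chronPast h f ζ U x = commonPast h f ζ U (chronFuture h f ζ U x) ∧
    chronFuture h f ζ U x = commonFuture h f ζ U (chronPast h f ζ U x)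

/-- The manifold underlying the Morse geometry: all points but the critical points of `f`. -/
def punctured (n : ℕ) [NeZero n] {M : Type*} [TopologicalSpace M]
    [ChartedSpace (EuclideanHalfSpace n) M] (f : M → ℝ) : Set M :=
  (criticalSet n f)ᶜ

/-- The slab `f⁻¹([a, b])` without the critical points of `f`. -/
def slab (n : ℕ) [NeZero n] {M : Type*} [TopologicalSpace M]
    [ChartedSpace (EuclideanHalfSpace n) M] (f : M → ℝ) (a b : ℝ) : Set M :=
  f ⁻¹' Icc a b \ criticalSet n f

/-- The levels `0 = a₀ < a₁ < ⋯ < a_r = 1` cut the cobordism into the `r` elementary cobordisms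
`f⁻¹([a_k, a_{k+1}])`: no level `a_k` is a critical value, and each of the pieces contains
exactly one critical point. -/
structure IsElementaryDecomposition (n : ℕ) [NeZero n] {M : Type*} [TopologicalSpace M]
    [ChartedSpace (EuclideanHalfSpace n) M] (f : M → ℝ) {r : ℕ} (a : Fin (r + 1) → ℝ) :
    Prop where
  strictMono : StrictMono a
  first : a 0 = 0
  last : a (Fin.last r) = 1
  regular : ∀ k, ∀ p ∈ criticalSet n f, f p ≠ a k
  one_critical : ∀ k : Fin r,
    ∃! p, p ∈ criticalSet n f ∧ f p ∈ Icc (a k.castSucc) (a k.succ)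

end Definitions

end MorseGeometry

end

noncomputable section

namespace MorseGeometry

set_option linter.unusedSectionVars false
set_option maxSynthPendingDepth 3

/-! ### Morse metric, differential and gradient in a chart -/

section

/-! Since `f` increases strictly along timelike curves, a timelike curve with endpoints in a slab
stays in the slab. So chronology in a slab is that of the whole Morse geometry (`chron_slab_iff`),
and only the points `x`, `y` that are tested change from slab to slab. Replacing `f` by `1 - f`
reverses time, so it suffices to treat the condition on pasts. That condition is recast as `PushUp`
(`pastContinuous_slab_iff`): if `y ≪ y'` and `y'` precedes all of `I⁺(x)`, then `y ≪ x`. Restricting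
`PushUp` to a smaller slab is trivial; the content is gluing two slabs along a regular level `c`.

Near a regular point the light cones are uniformly controlled (`exists_coneBounds`), so a curve with
small increase of `f` that ends near the point stays in the chart. Moving such a curve backwards
along a fixed timelike vector `e`, by an amount `σ exp(-Λ f)` that decreases along the curve, keeps
it timelike: the extra tilt beats the variation of the metric. A curve from `y'` to a point just
after `x` then becomes one from a point still in `I⁺(y)` to a point before `x`
(`exists_pushUp_nhds`). Compactness of the level makes this uniform, giving `PushUp` in a thin slab
around `c` (`exists_pushUp_level`).

Overlapping slabs are combined by a limit argument (`PushUp.union`): curves from near `y` to points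
tending to `x` cross a regular level in the overlap, compactness gives a limit `z₀` of the
crossings, and push-up below and above yields `y ≪ z₀` and then `y ≪ x`. Two unions through the thin
slab glue at `c` (`PushUp.glue`).

For existence of a decomposition, nondegenerate critical points are isolated, hence finite in number
by compactness, and levels can be placed between the ordered critical values. -/

theorem isInvertible_of_posDef {E : Type*} [NormedAddCommGroup E] [NormedSpace ℝ E]
    [FiniteDimensional ℝ E] (B : E →L[ℝ] E →L[ℝ] ℝ) (hB : ∀ v, v ≠ 0 → 0 < B v v) :
    B.IsInvertible := by
  have hinj : Function.Injective B.toLinearMap := by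
    refine (injective_iff_map_eq_zero _).2 fun u hu => ?_
    by_contra hne
    have h1 := hB u hne
    have h2 : B u = 0 := hu
    simp [h2] at h1
  have hdim : Module.finrank ℝ E = Module.finrank ℝ (E →L[ℝ] ℝ) := by
    rw [← (LinearMap.toContinuousLinearMap : (E →ₗ[ℝ] ℝ) ≃ₗ[ℝ] (E →L[ℝ] ℝ)).finrank_eq]
    exact (Subspace.dual_finrank_eq (K := ℝ) (V := E)).symm
  exact ⟨(LinearEquiv.ofInjectiveOfFinrankEq _ hinj hdim).toContinuousLinearEquiv, by ext; rfl⟩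

variable {n : ℕ} [NeZero n] {M : Type*} [TopologicalSpace M]
  [ChartedSpace (EuclideanHalfSpace n) M] [IsManifold (𝓡∂ n) ∞ M]

/-- The coordinate frame of the preferred chart at `x₀`, at the point `p` of its domain. -/
def frame (x₀ p : M) : Model n →L[ℝ] TangentSpace (𝓡∂ n) p :=
  (trivializationAt (Model n) (TangentSpace (𝓡∂ n)) x₀).symmL ℝ p

/-- The Riemannian metric in the preferred chart at `x₀`. -/
def coordMetric (h : RiemannianMetric n M) (x₀ : M) (u : Model n) :
    Model n →L[ℝ] Model n →L[ℝ] ℝ :=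
  (ContinuousLinearMap.precomp ℝ (frame x₀ ((extChartAt (𝓡∂ n) x₀).symm u))).comp
    ((h.inner ((extChartAt (𝓡∂ n) x₀).symm u)).comp (frame x₀ ((extChartAt (𝓡∂ n) x₀).symm u)))

/-- The differential of `f` in the preferred chart at `x₀`. -/
def coordDiff (f : M → ℝ) (x₀ : M) (u : Model n) : Model n →L[ℝ] ℝ :=
  (differential f ((extChartAt (𝓡∂ n) x₀).symm u)).comp (frame x₀ ((extChartAt (𝓡∂ n) x₀).symm u))

theorem coordMetric_apply (h : RiemannianMetric n M) (x₀ : M) (u v w : Model n) :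
    coordMetric h x₀ u v w = h.inner ((extChartAt (𝓡∂ n) x₀).symm u)
      (frame x₀ ((extChartAt (𝓡∂ n) x₀).symm u) v)
      (frame x₀ ((extChartAt (𝓡∂ n) x₀).symm u) w) := rfl

theorem coordDiff_apply (f : M → ℝ) (x₀ : M) (u w : Model n) :
    coordDiff f x₀ u w = differential f ((extChartAt (𝓡∂ n) x₀).symm u)
      (frame x₀ ((extChartAt (𝓡∂ n) x₀).symm u) w) := rfl

theorem frame_eq (x₀ : M) {u : Model n} (hu : u ∈ (extChartAt (𝓡∂ n) x₀).target) :
    frame x₀ ((extChartAt (𝓡∂ n) x₀).symm u) =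
      mfderivWithin 𝓘(ℝ, Model n) (𝓡∂ n) (extChartAt (𝓡∂ n) x₀).symm (range (𝓡∂ n)) u := by
  have hs := (extChartAt (𝓡∂ n) x₀).map_target hu
  rw [frame, TangentBundle.symmL_trivializationAt (by rwa [extChartAt_source] at hs),
    (extChartAt (𝓡∂ n) x₀).right_inv hu]

theorem mfderiv_frame (x₀ : M) {p : M} (hp : p ∈ (extChartAt (𝓡∂ n) x₀).source) (w : Model n) :
    mfderiv (𝓡∂ n) 𝓘(ℝ, Model n) (extChartAt (𝓡∂ n) x₀) p (frame x₀ p w) = w := by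
  have h1 := mfderiv_extChartAt_comp_mfderivWithin_extChartAt_symm' (I := 𝓡∂ n) hp
  rw [← TangentBundle.symmL_trivializationAt (by rwa [extChartAt_source] at hp)] at h1
  exact DFunLike.congr_fun h1 w

theorem frame_mfderiv (x₀ : M) {p : M} (hp : p ∈ (extChartAt (𝓡∂ n) x₀).source)
    (v : TangentSpace (𝓡∂ n) p) :
    frame x₀ p (mfderiv (𝓡∂ n) 𝓘(ℝ, Model n) (extChartAt (𝓡∂ n) x₀) p v) = v := by
  have h1 := mfderivWithin_extChartAt_symm_comp_mfderiv_extChartAt' (I := 𝓡∂ n) hp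
  rw [← TangentBundle.symmL_trivializationAt (by rwa [extChartAt_source] at hp)] at h1
  exact DFunLike.congr_fun h1 v

theorem frame_ne_zero (x₀ : M) {p : M} (hp : p ∈ (extChartAt (𝓡∂ n) x₀).source) {w : Model n}
    (hw : w ≠ 0) : frame x₀ p w ≠ 0 := by
  intro h0
  have := mfderiv_frame x₀ hp w
  rw [h0, map_zero] at this
  exact hw this.symm

theorem coordMetric_pos (h : RiemannianMetric n M) (x₀ : M) {u : Model n}
    (hu : u ∈ (extChartAt (𝓡∂ n) x₀).target) (w : Model n) (hw : w ≠ 0) :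
    0 < coordMetric h x₀ u w w :=
  h.pos _ _ (frame_ne_zero x₀ ((extChartAt (𝓡∂ n) x₀).map_target hu) hw)

theorem contDiffOn_coordMetric (h : RiemannianMetric n M) (x₀ : M) :
    ContDiffOn ℝ ∞ (coordMetric h x₀) (extChartAt (𝓡∂ n) x₀).target := by
  rw [contDiffOn_clm_apply]
  intro v
  rw [contDiffOn_clm_apply]
  intro w u hu
  have hs : (extChartAt (𝓡∂ n) x₀).symm u ∈
      (trivializationAt (Model n) (TangentSpace (𝓡∂ n)) x₀).baseSet := by
    have := (extChartAt (𝓡∂ n) x₀).map_target hu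
    rwa [extChartAt_source] at this
  have hfr (w : Model n) : ContMDiffAt (𝓡∂ n) ((𝓡∂ n).prod 𝓘(ℝ, Model n)) ∞
      (fun p : M => Bundle.TotalSpace.mk' (Model n) (E := TangentSpace (𝓡∂ n)) p (frame x₀ p w))
      ((extChartAt (𝓡∂ n) x₀).symm u) := by
    have h1 := (trivializationAt (Model n) (TangentSpace (𝓡∂ n)) x₀).contMDiffAt_symmL
      (IB := 𝓡∂ n) (n := ∞) hs
    have h2 : ContMDiffAt (𝓡∂ n) ((𝓡∂ n).prod 𝓘(ℝ, Model n)) ∞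
      (fun p : M => Bundle.TotalSpace.mk' (Model n) (E := Bundle.Trivial M (Model n)) p w)
      ((extChartAt (𝓡∂ n) x₀).symm u) := by
      rw [Bundle.contMDiffAt_section]
      exact contMDiffAt_const
    exact h1.clm_bundle_apply h2
  have h3 := (h.contMDiff ((extChartAt (𝓡∂ n) x₀).symm u)).clm_bundle_apply₂
    (E₃ := Bundle.Trivial M ℝ) (hfr v) (hfr w)
  rw [Bundle.contMDiffAt_section] at h3
  have h4 := h3.comp_contMDiffWithinAt u (contMDiffWithinAt_extChartAt_symm_target x₀ hu)
  exact contMDiffWithinAt_iff_contDiffWithinAt.1 h4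

theorem coordDiff_eq_fderivWithin {f : M → ℝ} (hf : ContMDiff (𝓡∂ n) 𝓘(ℝ, ℝ) ∞ f) (x₀ : M)
    {u : Model n} (hu : u ∈ (extChartAt (𝓡∂ n) x₀).target) :
    coordDiff f x₀ u =
      fderivWithin ℝ (f ∘ (extChartAt (𝓡∂ n) x₀).symm) (range (𝓡∂ n)) u := by
  have hU : UniqueMDiffWithinAt 𝓘(ℝ, Model n) (range (𝓡∂ n)) u :=
    (𝓡∂ n).uniqueMDiffOn u (extChartAt_target_subset_range x₀ hu)
  rw [← mfderivWithin_eq_fderivWithin, mfderiv_comp_mfderivWithin u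
    (hf.mdifferentiableAt (by simp)) (mdifferentiableWithinAt_extChartAt_symm hu) hU,
    ← frame_eq x₀ hu]
  rfl

theorem contDiffOn_coordDiff {f : M → ℝ} (hf : ContMDiff (𝓡∂ n) 𝓘(ℝ, ℝ) ∞ f) (x₀ : M) :
    ContDiffOn ℝ ∞ (coordDiff f x₀) (extChartAt (𝓡∂ n) x₀).target := by
  intro u hu
  have h1 : ContDiffWithinAt ℝ ∞ (f ∘ (extChartAt (𝓡∂ n) x₀).symm) (range (𝓡∂ n)) u :=
    contMDiffWithinAt_iff_contDiffWithinAt.1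
      ((hf _).comp_contMDiffWithinAt u (contMDiffWithinAt_extChartAt_symm_range x₀ hu))
  have h2 := h1.fderivWithin_right (m := ∞) (𝓡∂ n).uniqueDiffOn (by simp)
    (extChartAt_target_subset_range x₀ hu)
  exact (h2.mono (extChartAt_target_subset_range x₀)).congr
    (fun y hy => coordDiff_eq_fderivWithin hf x₀ hy) (coordDiff_eq_fderivWithin hf x₀ hu)

/-- The gradient of `f` in the preferred chart at `x₀`. -/
def coordGrad (h : RiemannianMetric n M) (f : M → ℝ) (x₀ : M) (u : Model n) : Model n :=
  (coordMetric h x₀ u).inverse (coordDiff f x₀ u)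

theorem coordMetric_coordGrad (h : RiemannianMetric n M) (f : M → ℝ) (x₀ : M) {u : Model n}
    (hu : u ∈ (extChartAt (𝓡∂ n) x₀).target) :
    coordMetric h x₀ u (coordGrad h f x₀ u) = coordDiff f x₀ u := by
  obtain ⟨e, he⟩ := isInvertible_of_posDef _ (coordMetric_pos h x₀ hu)
  rw [coordGrad, ← he, ContinuousLinearMap.inverse_equiv]
  exact e.apply_symm_apply _

/-- Both vectors have the same `h`-product with every vector, namely `df`, and positivity of `h` on
their difference forces equality. -/
theorem frame_coordGrad (h : RiemannianMetric n M) (f : M → ℝ) (x₀ : M) {u : Model n}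
    (hu : u ∈ (extChartAt (𝓡∂ n) x₀).target) :
    frame x₀ ((extChartAt (𝓡∂ n) x₀).symm u) (coordGrad h f x₀ u) =
      gradient h f ((extChartAt (𝓡∂ n) x₀).symm u) := by
  by_contra hne
  have hu' := (extChartAt (𝓡∂ n) x₀).map_target hu
  have hE : coordMetric h x₀ u (coordGrad h f x₀ u) = coordDiff f x₀ u :=
    coordMetric_coordGrad h f x₀ hu
  have key (p : M) (hp : p ∈ (extChartAt (𝓡∂ n) x₀).source) (v : Model n)
      (hv : ∀ w, h.inner p (frame x₀ p v) (frame x₀ p w) = differential f p (frame x₀ p w)) :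
      frame x₀ p v = gradient h f p := by
    by_contra hne
    have h1 := h.pos p _ (sub_ne_zero.2 hne)
    have h2 := hv (mfderiv (𝓡∂ n) 𝓘(ℝ, Model n) (extChartAt (𝓡∂ n) x₀) p
      (frame x₀ p v - gradient h f p))
    rw [frame_mfderiv x₀ hp, ← inner_gradient h f p] at h2
    have h3 : h.inner p (frame x₀ p v - gradient h f p) (frame x₀ p v - gradient h f p) =
        h.inner p (frame x₀ p v) (frame x₀ p v - gradient h f p) -
        h.inner p (gradient h f p) (frame x₀ p v - gradient h f p) := by
      rw [map_sub (h.inner p)]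
      rfl
    rw [h3, h2, sub_self] at h1
    exact lt_irrefl _ h1
  exact hne (key _ hu' _ fun w => DFunLike.congr_fun hE w)

theorem contDiffOn_coordGrad (h : RiemannianMetric n M) {f : M → ℝ}
    (hf : ContMDiff (𝓡∂ n) 𝓘(ℝ, ℝ) ∞ f) (x₀ : M) :
    ContDiffOn ℝ ∞ (coordGrad h f x₀) (extChartAt (𝓡∂ n) x₀).target := by
  intro u hu
  obtain ⟨e, he⟩ := isInvertible_of_posDef _ (coordMetric_pos h x₀ hu)
  have h1 : ContDiffAt ℝ ∞ ContinuousLinearMap.inverse (coordMetric h x₀ u) := by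
    rw [← he]; exact contDiffAt_map_inverse e
  exact (h1.comp_contDiffWithinAt u (contDiffOn_coordMetric h x₀ u hu)).clm_apply
    (contDiffOn_coordDiff hf x₀ u hu)

/-- The Morse metric in the preferred chart at `x₀`. -/
def coordMorse (h : RiemannianMetric n M) (f : M → ℝ) (ζ : ℝ) (x₀ : M) (u : Model n) :
    Model n →L[ℝ] Model n →L[ℝ] ℝ :=
  coordDiff f x₀ u (coordGrad h f x₀ u) • coordMetric h x₀ u -
    ζ • (coordDiff f x₀ u).smulRight (coordDiff f x₀ u)

theorem coordMorse_apply (h : RiemannianMetric n M) (f : M → ℝ) (ζ : ℝ) (x₀ : M)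
    (u v w : Model n) : coordMorse h f ζ x₀ u v w =
      coordDiff f x₀ u (coordGrad h f x₀ u) * coordMetric h x₀ u v w -
        ζ * (coordDiff f x₀ u v * coordDiff f x₀ u w) := by
  simp [coordMorse]

theorem contDiffOn_coordMorse (h : RiemannianMetric n M) {f : M → ℝ}
    (hf : ContMDiff (𝓡∂ n) 𝓘(ℝ, ℝ) ∞ f) (ζ : ℝ) (x₀ : M) :
    ContDiffOn ℝ ∞ (coordMorse h f ζ x₀) (extChartAt (𝓡∂ n) x₀).target := by
  have hd := contDiffOn_coordDiff hf x₀
  have hm := contDiffOn_coordMetric h x₀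
  rw [contDiffOn_clm_apply]
  intro v
  rw [contDiffOn_clm_apply]
  intro w
  simp only [coordMorse_apply]
  exact ((hd.clm_apply (contDiffOn_coordGrad h hf x₀)).mul
    ((hm.clm_apply contDiffOn_const).clm_apply contDiffOn_const)).sub
    (contDiffOn_const.mul ((hd.clm_apply contDiffOn_const).mul (hd.clm_apply contDiffOn_const)))

/-- `w` is a future-directed timelike vector at `u`, in the preferred chart at `x₀`. -/
def CoordTimelike (h : RiemannianMetric n M) (f : M → ℝ) (ζ : ℝ) (x₀ : M) (u w : Model n) : Prop :=
  coordMorse h f ζ x₀ u w w < 0 ∧ 0 < coordDiff f x₀ u w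

theorem coordTimelike_iff (h : RiemannianMetric n M) (f : M → ℝ) (ζ : ℝ) (x₀ : M) {u : Model n}
    (hu : u ∈ (extChartAt (𝓡∂ n) x₀).target) (w : Model n) :
    CoordTimelike h f ζ x₀ u w ↔ IsFutureTimelike h f ζ ((extChartAt (𝓡∂ n) x₀).symm u)
      (frame x₀ ((extChartAt (𝓡∂ n) x₀).symm u) w) := by
  rw [CoordTimelike, IsFutureTimelike, coordMorse_apply, morseMetric, ← frame_coordGrad h f x₀ hu]
  rfl

theorem coordMorse_comm (h : RiemannianMetric n M) (f : M → ℝ) (ζ : ℝ) (x₀ : M)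
    (u v w : Model n) : coordMorse h f ζ x₀ u v w = coordMorse h f ζ x₀ u w v := by
  rw [coordMorse_apply, coordMorse_apply, coordMetric_apply, coordMetric_apply, h.symm]
  ring

end

/-! ### Uniform light-cone estimates near a regular point -/

section

theorem exists_le_of_posDef {E : Type*} [NormedAddCommGroup E] [NormedSpace ℝ E]
    [FiniteDimensional ℝ E] (B : E →L[ℝ] E →L[ℝ] ℝ) (hB : ∀ v, v ≠ 0 → 0 < B v v) :
    ∃ m > 0, ∀ v, m * ‖v‖ ^ 2 ≤ B v v := by
  rcases subsingleton_or_nontrivial E with hE | hE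
  · exact ⟨1, one_pos, fun v => by simp [Subsingleton.elim v 0]⟩
  obtain ⟨v₀, hv₀, hmin⟩ := (isCompact_sphere (0 : E) 1).exists_isMinOn
    (NormedSpace.sphere_nonempty.2 zero_le_one) (f := fun v => B v v) (by fun_prop)
  have hne : v₀ ≠ 0 := by rintro rfl; simp at hv₀
  refine ⟨B v₀ v₀, hB _ hne, fun v => ?_⟩
  rcases eq_or_ne v 0 with rfl | hv
  · simp
  have hn : 0 < ‖v‖ := norm_pos_iff.2 hv
  have h1 : B v₀ v₀ ≤ B (‖v‖⁻¹ • v) (‖v‖⁻¹ • v) :=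
    isMinOn_iff.1 hmin _ (by simp [norm_smul, hn.ne'])
  have h2 : B (‖v‖⁻¹ • v) (‖v‖⁻¹ • v) = ‖v‖⁻¹ ^ 2 * B v v := by simp; ring
  rw [h2, inv_pow, ← div_eq_inv_mul, le_div_iff₀ (by positivity)] at h1
  exact h1

theorem abs_clm_apply₂_le {E : Type*} [NormedAddCommGroup E] [NormedSpace ℝ E]
    (B C : E →L[ℝ] E →L[ℝ] ℝ) (v w : E) : |B v w - C v w| ≤ ‖B - C‖ * ‖v‖ * ‖w‖ :=
  (B - C).le_opNorm₂ v w

/-- In the application `Q` is the Morse metric, `l = df` and `e` the gradient at the centre. Then `Q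
+ ζ l ⊗ l` is `|∇f|² h`, positive definite, so `Q u w w < 0` bounds `‖w‖` by a multiple of `l u w`.
At the centre, `Q(·, e)` is a negative multiple of `l` because `ζ > 1`. Both facts persist nearby by
continuity. -/
theorem exists_cone_estimates {E : Type*} [NormedAddCommGroup E] [NormedSpace ℝ E]
    [FiniteDimensional ℝ E] {s : Set E} {u₀ e : E} (hs : Convex ℝ s)
    {Q : E → E →L[ℝ] E →L[ℝ] ℝ} {l : E → E →L[ℝ] ℝ}
    (hQ : ContDiffWithinAt ℝ 1 Q s u₀) (hl : ContinuousWithinAt l s u₀) {ζ : ℝ} (hζ : 1 < ζ)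
    (he : 0 < l u₀ e) (hQe : ∀ w, Q u₀ w e = -((ζ - 1) * l u₀ e) * l u₀ w)
    (hpos : ∀ v, v ≠ 0 → 0 < Q u₀ v v + ζ * (l u₀ v * l u₀ v)) :
    ∃ K > 0, ∃ κ > 0, ∃ L ≥ 0, ∃ t ∈ 𝓝[s] u₀,
      (∀ u ∈ t, (Q u e e < 0 ∧ 0 < l u e) ∧ ∀ w, Q u w w < 0 → 0 < l u w →
        ‖w‖ ≤ K * l u w ∧ Q u w e ≤ -κ * l u w) ∧
      ∀ u ∈ t, ∀ u' ∈ t, ‖Q u - Q u'‖ ≤ L * ‖u - u'‖ ∧ ‖l u - l u'‖ * (2 * K) < 1 := by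
  have hQc := hQ.continuousWithinAt
  have hζ0 : 0 < ζ - 1 := by linarith
  let P : E → E →L[ℝ] E →L[ℝ] ℝ := fun u => Q u + ζ • (l u).smulRight (l u)
  have hP (u w : E) : P u w w = Q u w w + ζ * (l u w * l u w) := by simp [P]
  obtain ⟨m, hm, hmle⟩ := exists_le_of_posDef (P u₀) fun v hv => by
    rw [hP]; exact hpos v hv
  have hPc : ContinuousWithinAt P s u₀ := by
    have h1 : ContinuousWithinAt (fun u => (l u).smulRight (l u)) s u₀ :=
      ((ContinuousLinearMap.smulRightL ℝ E (E →L[ℝ] ℝ)).continuous.continuousAt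
        |>.comp_continuousWithinAt hl).clm_apply hl
    exact hQc.add (h1.const_smul ζ)
  obtain ⟨K, hK0, hK⟩ : ∃ K > 0, K ^ 2 = 2 * ζ / m :=
    ⟨Real.sqrt (2 * ζ / m), Real.sqrt_pos.2 (by positivity), Real.sq_sqrt (by positivity)⟩
  obtain ⟨κ, hκ0, hκ⟩ : ∃ κ > 0, 2 * κ = (ζ - 1) * l u₀ e :=
    ⟨(ζ - 1) * l u₀ e / 2, by positivity, by ring⟩
  -- `θ` vanishes at `u₀`, so nearby `|θ u w| ≤ (κ / K) ‖w‖ ≤ κ l u w`; half of the coefficient `2κ`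
  -- survives.
  let θ : E → E →L[ℝ] ℝ := fun u => (Q u).flip e + (2 * κ) • l u
  have hθ (u w : E) : θ u w = Q u w e + 2 * κ * l u w := by simp [θ]
  have hθc : ContinuousWithinAt θ s u₀ := by
    have h1 : ContinuousWithinAt (fun u => (Q u).flip) s u₀ :=
      (ContinuousLinearMap.flipₗᵢ ℝ E E ℝ).continuous.continuousAt.comp_continuousWithinAt hQc
    exact (h1.clm_apply continuousWithinAt_const).add (hl.const_smul (2 * κ))
  have hθ₀ : θ u₀ = 0 := by
    ext w
    rw [hθ, hQe, hκ, zero_apply]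
    ring
  have ev1 : ∀ᶠ u in 𝓝[s] u₀, ‖P u - P u₀‖ < m / 2 := by
    simpa only [dist_eq_norm] using Metric.tendsto_nhds.1 hPc.tendsto (m / 2) (by positivity)
  have ev2 : ∀ᶠ u in 𝓝[s] u₀, ‖θ u‖ < κ / K := by
    have := Metric.tendsto_nhds.1 hθc.tendsto (κ / K) (by positivity)
    rw [hθ₀] at this
    simpa only [dist_zero_right] using this
  have ev3 : ∀ᶠ u in 𝓝[s] u₀, Q u e e < 0 ∧ 0 < l u e := by
    have h1 : Q u₀ e e < 0 := by
      rw [hQe]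
      have : 0 < (ζ - 1) * l u₀ e * l u₀ e := by positivity
      linarith
    have c1 : ContinuousWithinAt (fun u => Q u e e) s u₀ :=
      (hQc.clm_apply continuousWithinAt_const).clm_apply continuousWithinAt_const
    have c2 : ContinuousWithinAt (fun u => l u e) s u₀ := hl.clm_apply continuousWithinAt_const
    exact (c1.eventually (gt_mem_nhds h1)).and (c2.eventually (lt_mem_nhds he))
  have ev4 : ∀ᶠ u in 𝓝[s] u₀, ‖l u - l u₀‖ < 1 / (4 * K) := by
    simpa only [dist_eq_norm] using Metric.tendsto_nhds.1 hl.tendsto (1 / (4 * K)) (by positivity)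
  obtain ⟨L, t, ht, hL⟩ := hQ.exists_lipschitzOnWith hs
  refine ⟨K, hK0, κ, hκ0, L, L.2, _, (((ev1.and ev2).and ev3).and ev4).and ht, ?_, ?_⟩
  · rintro u ⟨⟨⟨⟨h1, h2⟩, h3⟩, -⟩, -⟩
    refine ⟨h3, fun w hw hw' => ?_⟩
    have hn : ‖w‖ ≤ K * l u w := by
      have h4 : (m / 2) * ‖w‖ ^ 2 ≤ P u w w := by
        have h3 := abs_clm_apply₂_le (P u) (P u₀) w w
        have h4 : ‖P u - P u₀‖ * ‖w‖ * ‖w‖ ≤ m / 2 * ‖w‖ * ‖w‖ := by gcongr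
        have h5 := (abs_le.1 h3).1
        have h6 := hmle w
        linarith
      rw [hP] at h4
      have h6 : ‖w‖ ^ 2 ≤ (K * l u w) ^ 2 := by
        rw [mul_pow, hK, div_mul_eq_mul_div, le_div_iff₀ hm]
        linarith
      exact (pow_le_pow_iff_left₀ (norm_nonneg _) (by positivity) two_ne_zero).1 h6
    refine ⟨hn, ?_⟩
    have h4 := (θ u).le_opNorm w
    rw [hθ, Real.norm_eq_abs] at h4
    have h5 : ‖θ u‖ * ‖w‖ ≤ κ / K * (K * l u w) := by gcongr
    rw [← mul_assoc, div_mul_cancel₀ _ hK0.ne'] at h5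
    have h6 := (abs_le.1 h4).2
    linarith
  · rintro u ⟨⟨-, h1⟩, h2⟩ u' ⟨⟨-, h1'⟩, h2'⟩
    refine ⟨hL.norm_sub_le h2 h2', ?_⟩
    have h3 : ‖l u - l u'‖ < 1 / (2 * K) := by
      calc ‖l u - l u'‖ = ‖(l u - l u₀) - (l u' - l u₀)‖ := by congr 1; abel
        _ ≤ ‖l u - l u₀‖ + ‖l u' - l u₀‖ := norm_sub_le _ _
        _ < 1 / (4 * K) + 1 / (4 * K) := add_lt_add h1 h1'
        _ = 1 / (2 * K) := by field_simp; norm_num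
    rwa [lt_div_iff₀ (by positivity)] at h3

variable {n : ℕ} [NeZero n] {M : Type*} [TopologicalSpace M]
  [ChartedSpace (EuclideanHalfSpace n) M] [IsManifold (𝓡∂ n) ∞ M]

/-- The part of the model half space within distance `ρ` of the coordinates of `x₀`. -/
def coordBall (x₀ : M) (ρ : ℝ) : Set (Model n) :=
  Metric.ball (extChartAt (𝓡∂ n) x₀ x₀) ρ ∩ range (𝓡∂ n)

theorem coordBall_mono (x₀ : M) {ρ ρ' : ℝ} (hρ : ρ ≤ ρ') :
    coordBall x₀ ρ ⊆ coordBall (n := n) x₀ ρ' :=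
  inter_subset_inter_left _ (Metric.ball_subset_ball hρ)

theorem exists_coordBall {x₀ : M} {p : Model n → Prop}
    (hp : ∀ᶠ u in 𝓝[range (𝓡∂ n)] (extChartAt (𝓡∂ n) x₀ x₀), p u) :
    ∃ ρ > 0, ∀ u ∈ coordBall (n := n) x₀ ρ, p u := by
  obtain ⟨ρ, hρ, h⟩ := Metric.mem_nhdsWithin_iff.1 hp
  exact ⟨ρ, hρ, fun u hu => h hu⟩

/-- Uniform bounds on the light cones near `x₀`: timelike vectors are controlled by `df`, `e` is
uniformly timelike, and the metric is Lipschitz. -/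
structure ConeBounds (h : RiemannianMetric n M) (f : M → ℝ) (ζ : ℝ) (x₀ : M)
    (ρ K κ L : ℝ) (e : Model n) : Prop where
  rho_pos : 0 < ρ
  K_pos : 0 < K
  kappa_pos : 0 < κ
  L_nonneg : 0 ≤ L
  subset_target : coordBall (n := n) x₀ ρ ⊆ (extChartAt (𝓡∂ n) x₀).target
  norm_le : ∀ u ∈ coordBall (n := n) x₀ ρ, ∀ w, CoordTimelike h f ζ x₀ u w → ‖w‖ ≤ K * coordDiff f x₀ u w
  morse_le : ∀ u ∈ coordBall (n := n) x₀ ρ, ∀ w, CoordTimelike h f ζ x₀ u w →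
    coordMorse h f ζ x₀ u w e ≤ -κ * coordDiff f x₀ u w
  timelike : ∀ u ∈ coordBall (n := n) x₀ ρ, CoordTimelike h f ζ x₀ u e
  lipschitz : ∀ u ∈ coordBall (n := n) x₀ ρ, ∀ u' ∈ coordBall (n := n) x₀ ρ,
    ‖coordMorse h f ζ x₀ u - coordMorse h f ζ x₀ u'‖ ≤ L * ‖u - u'‖
  osc : ∀ u ∈ coordBall (n := n) x₀ ρ, ∀ u' ∈ coordBall (n := n) x₀ ρ,
    ‖coordDiff f x₀ u - coordDiff f x₀ u'‖ * (2 * K) < 1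

theorem coordDiff_ne_zero {f : M → ℝ} {x₀ : M} (hx₀ : x₀ ∉ criticalSet n f) :
    coordDiff f x₀ (extChartAt (𝓡∂ n) x₀ x₀) ≠ 0 := by
  intro h0
  apply hx₀
  have key (p : M) (hp : p ∈ (extChartAt (𝓡∂ n) x₀).source)
      (h1 : ∀ w, differential (n := n) f p (frame x₀ p w) = 0) : differential (n := n) f p = 0 := by
    ext v
    exact (congrArg (differential f p) (frame_mfderiv x₀ hp v).symm).trans (h1 _)
  refine key x₀ (mem_extChartAt_source x₀) fun w => ?_
  have h2 := DFunLike.congr_fun h0 w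
  rw [coordDiff_apply, extChartAt_to_inv] at h2
  exact h2

theorem exists_coneBounds (h : RiemannianMetric n M) {f : M → ℝ}
    (hf : ContMDiff (𝓡∂ n) 𝓘(ℝ, ℝ) ∞ f) {ζ : ℝ} (hζ : 1 < ζ) {x₀ : M}
    (hx₀ : x₀ ∉ criticalSet n f) : ∃ ρ K κ L e, ConeBounds h f ζ x₀ ρ K κ L e := by
  have hu₀ := mem_extChartAt_target (I := 𝓡∂ n) x₀
  have htar := extChartAt_target_mem_nhdsWithin (I := 𝓡∂ n) x₀
  have hgrad := coordMetric_coordGrad h f x₀ hu₀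
  have hpos := coordMetric_pos h x₀ hu₀
  have hl0 := coordDiff_ne_zero hx₀
  have hN : 0 < coordDiff f x₀ (extChartAt (𝓡∂ n) x₀ x₀)
      (coordGrad h f x₀ (extChartAt (𝓡∂ n) x₀ x₀)) := by
    rw [← hgrad]
    refine hpos _ fun h0 => hl0 ?_
    rw [← hgrad, h0, map_zero]
  obtain ⟨K, hK, κ, hκ, L, hL, t, ht, h1, h2⟩ := exists_cone_estimates (𝓡∂ n).convex_range
    (((contDiffOn_coordMorse h hf ζ x₀ _ hu₀).mono_of_mem_nhdsWithin htar).of_le (by simp))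
    ((contDiffOn_coordDiff hf x₀ _ hu₀).mono_of_mem_nhdsWithin htar).continuousWithinAt
    hζ hN
    (fun w => by
      rw [coordMorse_apply, coordMetric_apply, h.symm, ← coordMetric_apply, hgrad]; ring)
    (fun v hv => by
      rw [coordMorse_apply, sub_add_cancel]; exact mul_pos hN (hpos v hv))
  obtain ⟨ρ, hρ, hall⟩ := exists_coordBall (x₀ := x₀) (Filter.Eventually.and htar ht)
  exact ⟨ρ, K, κ, L, _, hρ, hK, hκ, hL, fun u hu => (hall u hu).1,
    fun u hu w hw => ((h1 u (hall u hu).2).2 w hw.1 hw.2).1,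
    fun u hu w hw => ((h1 u (hall u hu).2).2 w hw.1 hw.2).2,
    fun u hu => (h1 u (hall u hu).2).1,
    fun u hu u' hu' => (h2 u (hall u hu).2 u' (hall u' hu').2).1,
    fun u hu u' hu' => (h2 u (hall u hu).2 u' (hall u' hu').2).2⟩

/-- Moving the base point by `-η e` changes the metric by `O(η)`, which could spoil a nearly null
vector. Adding `a e` with `a = Λ η df(w)` contributes `2 a Q(w, e) ≤ -2 a κ df(w)`, and `Λ` is
chosen so that this dominates the error. -/
theorem ConeBounds.timelike_shift {h : RiemannianMetric n M} {f : M → ℝ} {ζ : ℝ} {x₀ : M}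
    {ρ K κ L : ℝ} {e : Model n} (cb : ConeBounds h f ζ x₀ ρ K κ L e) {u w : Model n} {η Λ : ℝ}
    (hu : u ∈ coordBall (n := n) x₀ ρ) (hu' : u - η • e ∈ coordBall (n := n) x₀ ρ) (hη : 0 ≤ η) (hΛ : 0 ≤ Λ)
    (hη' : Λ * η * ‖e‖ ≤ K) (hΛ' : 2 * L * K ^ 2 * ‖e‖ ≤ Λ * κ)
    (hw : CoordTimelike h f ζ x₀ u w) :
    CoordTimelike h f ζ x₀ (u - η • e) (w + (Λ * η * coordDiff f x₀ u w) • e) := by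
  set τ := coordDiff f x₀ u w with hτ
  set u' := u - η • e with hu'def
  have hτpos : 0 < τ := hw.2
  set a := Λ * η * τ with ha
  have ha0 : 0 ≤ a := by positivity
  set w₁ := w + a • e with hw₁
  have hK := cb.K_pos
  have hκ := cb.kappa_pos
  have hL := cb.L_nonneg
  have hn : ‖w₁‖ ≤ 2 * K * τ := by
    calc ‖w₁‖ ≤ ‖w‖ + ‖a • e‖ := norm_add_le _ _
      _ ≤ K * τ + K * τ := by
        refine add_le_add (cb.norm_le u hu w hw) ?_
        rw [norm_smul, Real.norm_eq_abs, abs_of_nonneg ha0]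
        calc a * ‖e‖ = (Λ * η * ‖e‖) * τ := by rw [ha]; ring
          _ ≤ K * τ := by gcongr
      _ = 2 * K * τ := by ring
  have hee := cb.timelike u hu
  constructor
  · have h1 : coordMorse h f ζ x₀ u w₁ w₁ = coordMorse h f ζ x₀ u w w +
        2 * a * coordMorse h f ζ x₀ u w e + a ^ 2 * coordMorse h f ζ x₀ u e e := by
      simp only [hw₁, map_add, add_apply, map_smul, smul_apply,
        smul_eq_mul, coordMorse_comm h f ζ x₀ u e w]
      ring
    have h2 := cb.morse_le u hu w hw
    have h3 := (abs_le.1 (abs_clm_apply₂_le (coordMorse h f ζ x₀ u') (coordMorse h f ζ x₀ u)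
      w₁ w₁)).2
    have h4 : ‖coordMorse h f ζ x₀ u' - coordMorse h f ζ x₀ u‖ ≤ L * (η * ‖e‖) := by
      refine (cb.lipschitz u' hu' u hu).trans_eq ?_
      rw [hu'def, sub_sub_cancel_left, norm_neg, norm_smul, Real.norm_eq_abs, abs_of_nonneg hη]
    have h5 : ‖coordMorse h f ζ x₀ u' - coordMorse h f ζ x₀ u‖ * ‖w₁‖ * ‖w₁‖ ≤
        L * (η * ‖e‖) * (2 * K * τ) * (2 * K * τ) := by gcongr
    have h6 : 2 * a * coordMorse h f ζ x₀ u w e ≤ 2 * a * (-κ * τ) := by gcongr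
    have h7 : a ^ 2 * coordMorse h f ζ x₀ u e e ≤ 0 :=
      mul_nonpos_of_nonneg_of_nonpos (by positivity) hee.1.le
    -- The error of the base-point change, with `‖w₁‖ ≤ 2 K τ`, is absorbed by the cross term of
    -- `h6`.
    have h8 : L * (η * ‖e‖) * (2 * K * τ) * (2 * K * τ) ≤ 2 * a * (κ * τ) := by
      calc _ = (2 * L * K ^ 2 * ‖e‖) * (2 * η * τ ^ 2) := by ring
        _ ≤ (Λ * κ) * (2 * η * τ ^ 2) := by gcongr
        _ = _ := by rw [ha]; ring
    have h9 := hw.1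
    linarith
  · have h1 : coordDiff f x₀ u w₁ = τ + a * coordDiff f x₀ u e := by
      simp [hw₁, hτ]
    have h2 : 0 ≤ a * coordDiff f x₀ u e := mul_nonneg ha0 hee.2.le
    have h3 := (coordDiff f x₀ u' - coordDiff f x₀ u).le_opNorm w₁
    have h4 : ‖coordDiff f x₀ u' - coordDiff f x₀ u‖ * ‖w₁‖ ≤
        ‖coordDiff f x₀ u' - coordDiff f x₀ u‖ * (2 * K * τ) := by gcongr
    have h5 := mul_lt_mul_of_pos_right (cb.osc u' hu' u hu) hτpos
    have h6 := (abs_le.1 h3).1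
    rw [sub_apply] at h6
    -- The oscillation bound makes the change of `df` on `w₁` strictly less than `τ`, so `df` stays
    -- positive.
    linarith

end

/-! ### Timelike curves, reparametrisation and time reversal -/

section

theorem HasMFDerivWithinAt.hasDerivWithinAt_vectorSpace {E : Type*} [NormedAddCommGroup E]
    [NormedSpace ℝ E] {c : ℝ → E} {s : Set ℝ} {t : ℝ}
    {v : TangentSpace 𝓘(ℝ, ℝ) t →L[ℝ] TangentSpace 𝓘(ℝ, E) (c t)}
    (hv : HasMFDerivWithinAt 𝓘(ℝ, ℝ) 𝓘(ℝ, E) c s t v) :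
    HasDerivWithinAt c (show E from v (1 : ℝ)) s t := by
  have h1 : HasFDerivWithinAt c (show ℝ →L[ℝ] E from v) s t :=
    hasMFDerivWithinAt_iff_hasFDerivWithinAt.1 hv
  exact h1.hasDerivWithinAt

variable {n : ℕ} [NeZero n] {M : Type*} [TopologicalSpace M]
  [ChartedSpace (EuclideanHalfSpace n) M] [IsManifold (𝓡∂ n) ∞ M]
  {h : RiemannianMetric n M} {f : M → ℝ} {ζ : ℝ} {U : Set M}

theorem IsFutureTimelike.smul {x : M} {v : TangentSpace (𝓡∂ n) x}
    (hv : IsFutureTimelike h f ζ x v) {c : ℝ} (hc : 0 < c) :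
    IsFutureTimelike h f ζ x (c • v) := by
  obtain ⟨h1, h2⟩ := hv
  constructor
  · have h3 : morseMetric h f ζ x (c • v) (c • v) = c ^ 2 * morseMetric h f ζ x v v := by
      simp only [morseMetric, map_smul, smul_apply, smul_eq_mul]
      ring
    rw [h3]
    exact mul_neg_of_pos_of_neg (by positivity) h1
  · rw [map_smul, smul_eq_mul]
    exact mul_pos hc h2

theorem CoordTimelike.smul {x₀ : M} {u w : Model n} (hw : CoordTimelike h f ζ x₀ u w) {c : ℝ}
    (hc : 0 < c) : CoordTimelike h f ζ x₀ u (c • w) := by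
  obtain ⟨h1, h2⟩ := hw
  constructor
  · have h3 : coordMorse h f ζ x₀ u (c • w) (c • w) = c ^ 2 * coordMorse h f ζ x₀ u w w := by
      simp only [map_smul, smul_apply, smul_eq_mul]
      ring
    rw [h3]
    exact mul_neg_of_pos_of_neg (by positivity) h1
  · rw [map_smul, smul_eq_mul]
    exact mul_pos hc h2

theorem isTimelikeCurve_iff {γ : ℝ → M} : IsTimelikeCurve h f ζ U γ ↔
    ∀ t ∈ Icc (0 : ℝ) 1, γ t ∈ U ∧ ∃ v : TangentSpace 𝓘(ℝ, ℝ) t →L[ℝ] TangentSpace (𝓡∂ n) (γ t),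
      HasMFDerivWithinAt 𝓘(ℝ, ℝ) (𝓡∂ n) γ (Icc 0 1) t v ∧
      IsFutureTimelike h f ζ (γ t) (v (1 : ℝ)) := by
  refine forall₂_congr fun t ht => and_congr_right fun _ => ⟨fun H => ?_, ?_⟩
  · exact ⟨_, H.1.hasMFDerivWithinAt, H.2⟩
  · rintro ⟨v, hv, hv'⟩
    refine ⟨hv.mdifferentiableWithinAt, ?_⟩
    rwa [hv.mfderivWithin ((uniqueDiffOn_Icc zero_lt_one).uniqueMDiffOn t ht)]

theorem IsTimelikeCurve.continuousOn {γ : ℝ → M} (hγ : IsTimelikeCurve h f ζ U γ) :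
    ContinuousOn γ (Icc 0 1) :=
  fun t ht => (hγ t ht).2.1.continuousWithinAt

theorem IsTimelikeCurve.mono {V : Set M} {γ : ℝ → M} (hγ : IsTimelikeCurve h f ζ U γ)
    (hV : ∀ t ∈ Icc (0 : ℝ) 1, γ t ∈ V) : IsTimelikeCurve h f ζ V γ :=
  fun t ht => ⟨hV t ht, (hγ t ht).2⟩

theorem IsTimelikeCurve.hasDerivWithinAt (hf : ContMDiff (𝓡∂ n) 𝓘(ℝ, ℝ) ∞ f) {γ : ℝ → M}
    (hγ : IsTimelikeCurve h f ζ U γ) {t : ℝ} (ht : t ∈ Icc (0 : ℝ) 1) :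
    ∃ d > 0, HasDerivWithinAt (f ∘ γ) d (Icc 0 1) t := by
  obtain ⟨-, v, hv, hv'⟩ := isTimelikeCurve_iff.1 hγ t ht
  have h1 := ((hf.mdifferentiableAt (x := γ t) (by simp)).hasMFDerivAt).comp_hasMFDerivWithinAt t hv
  exact ⟨_, hv'.2, HasMFDerivWithinAt.hasDerivWithinAt_vectorSpace h1⟩

theorem IsTimelikeCurve.strictMonoOn (hf : ContMDiff (𝓡∂ n) 𝓘(ℝ, ℝ) ∞ f) {γ : ℝ → M}
    (hγ : IsTimelikeCurve h f ζ U γ) : StrictMonoOn (f ∘ γ) (Icc 0 1) := by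
  refine strictMonoOn_of_deriv_pos (convex_Icc 0 1)
    (hf.continuous.comp_continuousOn hγ.continuousOn) fun t ht => ?_
  obtain ⟨d, hd, hd'⟩ := hγ.hasDerivWithinAt hf (interior_subset ht)
  rw [(hd'.hasDerivAt (mem_interior_iff_mem_nhds.1 ht)).deriv]
  exact hd

theorem IsTimelikeCurve.hasMFDerivWithinAt_comp {γ : ℝ → M} {a b t : ℝ}
    (hab : ∀ t ∈ Icc (0 : ℝ) 1, a + t * b ∈ Icc (0 : ℝ) 1) 
    {v : TangentSpace 𝓘(ℝ, ℝ) (a + t * b) →L[ℝ] TangentSpace (𝓡∂ n) (γ (a + t * b))}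
    (hv : HasMFDerivWithinAt 𝓘(ℝ, ℝ) (𝓡∂ n) γ (Icc 0 1) (a + t * b) v) :
    ∃ v' : TangentSpace 𝓘(ℝ, ℝ) t →L[ℝ] TangentSpace (𝓡∂ n) (γ (a + t * b)),
      HasMFDerivWithinAt 𝓘(ℝ, ℝ) (𝓡∂ n) (fun t => γ (a + t * b)) (Icc 0 1) t v' ∧
      v' (1 : ℝ) = b • v (1 : ℝ) := by
  have h1 : HasDerivWithinAt (fun t : ℝ => a + t * b) b (Icc 0 1) t := by
    simpa using ((hasDerivWithinAt_id t (Icc 0 1)).mul_const b).const_add a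
  have h2 := hv.comp (f := fun t : ℝ => a + t * b) (s := Icc 0 1) t
    (hasMFDerivWithinAt_iff_hasFDerivWithinAt.2 h1.hasFDerivWithinAt) hab
  refine ⟨_, h2, ?_⟩
  have h3 : v (b • (1 : ℝ)) = b • v (1 : ℝ) := v.map_smul b (1 : ℝ)
  rw [← h3]
  change v (ContinuousLinearMap.toSpanSingleton ℝ b (1 : ℝ)) = _
  simp

theorem IsTimelikeCurve.subcurve {γ : ℝ → M} (hγ : IsTimelikeCurve h f ζ U γ) {a b : ℝ}
    (ha : 0 ≤ a) (hab : a < b) (hb : b ≤ 1) :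
    ∃ δ, IsTimelikeCurve h f ζ U δ ∧ δ 0 = γ a ∧ δ 1 = γ b := by
  have hmap : ∀ t ∈ Icc (0 : ℝ) 1, a + t * (b - a) ∈ Icc (0 : ℝ) 1 := fun t ht =>
    ⟨by nlinarith [ht.1], by nlinarith [ht.2]⟩
  refine ⟨fun t => γ (a + t * (b - a)), isTimelikeCurve_iff.2 fun t ht => ?_, by simp, by simp⟩
  obtain ⟨h1, v, hv, hv'⟩ := isTimelikeCurve_iff.1 hγ _ (hmap t ht)
  obtain ⟨v', h2, h3⟩ := IsTimelikeCurve.hasMFDerivWithinAt_comp hmap hv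
  refine ⟨h1, v', h2, ?_⟩
  rw [h3]
  exact hv'.smul (sub_pos.2 hab)

theorem IsTimelikeCurve.chron {γ : ℝ → M} (hγ : IsTimelikeCurve h f ζ U γ) {a b : ℝ}
    (ha : 0 ≤ a) (hab : a < b) (hb : b ≤ 1) : Chron h f ζ U (γ a) (γ b) :=
  .single (hγ.subcurve ha hab hb)

theorem differential_one_sub (hf : ContMDiff (𝓡∂ n) 𝓘(ℝ, ℝ) ∞ f) (x : M) :
    differential (n := n) (fun x => 1 - f x) x = -differential f x := by
  have h1 : (fun x => 1 - f x) = (fun _ => (1 : ℝ)) - f := rfl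
  have h2 := ((hasMFDerivAt_const (I := 𝓡∂ n) (I' := 𝓘(ℝ, ℝ)) (1 : ℝ) x).sub
    (hf.mdifferentiableAt (x := x) (by simp)).hasMFDerivAt).mfderiv
  rw [differential, h1, h2]
  exact zero_sub _

/-- The Morse metric is even in `df`, so `1 - f` defines the same metric with the opposite time
orientation. Every statement about pasts thereby yields one about futures. -/
theorem isFutureTimelike_one_sub (hf : ContMDiff (𝓡∂ n) 𝓘(ℝ, ℝ) ∞ f) {x : M}
    {v : TangentSpace (𝓡∂ n) x} :
    IsFutureTimelike h (fun x => 1 - f x) ζ x v ↔ IsFutureTimelike h f ζ x (-v) := by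
  have hg : gradient h (fun x => 1 - f x) x = -gradient h f x := by
    rw [gradient, differential_one_sub hf, map_neg]; rfl
  simp only [IsFutureTimelike, morseMetric, hg, differential_one_sub hf, map_neg, neg_apply,
    mul_neg, neg_mul, neg_neg]

theorem chron_one_sub_of_chron (hf : ContMDiff (𝓡∂ n) 𝓘(ℝ, ℝ) ∞ f) {x y : M}
    (hxy : Chron h f ζ U x y) : Chron h (fun x => 1 - f x) ζ U y x := by
  refine Relation.transGen_swap.1 (Relation.TransGen.mono ?_ x y hxy)
  rintro x y ⟨γ, hγ, rfl, rfl⟩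
  have hmap : ∀ t ∈ Icc (0 : ℝ) 1, 1 + t * (-1) ∈ Icc (0 : ℝ) 1 := fun t ht =>
    ⟨by linarith [ht.2], by linarith [ht.1]⟩
  refine ⟨fun t => γ (1 + t * (-1)), isTimelikeCurve_iff.2 fun t ht => ?_, by simp, by simp⟩
  obtain ⟨h1, v, hv, hv'⟩ := isTimelikeCurve_iff.1 hγ _ (hmap t ht)
  obtain ⟨v', h2, h3⟩ := IsTimelikeCurve.hasMFDerivWithinAt_comp hmap hv
  refine ⟨h1, v', h2, ?_⟩
  rw [isFutureTimelike_one_sub hf, h3]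
  simpa using hv'

theorem chron_one_sub (hf : ContMDiff (𝓡∂ n) 𝓘(ℝ, ℝ) ∞ f) {x y : M} :
    Chron h (fun x => 1 - f x) ζ U x y ↔ Chron h f ζ U y x := by
  refine ⟨fun H => ?_, chron_one_sub_of_chron hf⟩
  have h1 := chron_one_sub_of_chron (contMDiff_const.sub hf) H
  simpa using h1

theorem CoordTimelike.isFutureTimelike_frame {x₀ p : M}
    (hp : p ∈ (extChartAt (𝓡∂ n) x₀).source) (w : Model n) :
    CoordTimelike h f ζ x₀ (extChartAt (𝓡∂ n) x₀ p) w ↔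
      IsFutureTimelike h f ζ p (frame x₀ p w) := by
  have h1 := coordTimelike_iff h f ζ x₀ ((extChartAt (𝓡∂ n) x₀).map_source hp) w
  rwa [(extChartAt (𝓡∂ n) x₀).left_inv hp] at h1

theorem IsTimelikeCurve.hasDerivWithinAt_coord (hf : ContMDiff (𝓡∂ n) 𝓘(ℝ, ℝ) ∞ f) {γ : ℝ → M}
    (hγ : IsTimelikeCurve h f ζ U γ) {t : ℝ} (ht : t ∈ Icc (0 : ℝ) 1) {x₀ : M}
    (hx₀ : γ t ∈ (extChartAt (𝓡∂ n) x₀).source) :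
    ∃ w, CoordTimelike h f ζ x₀ (extChartAt (𝓡∂ n) x₀ (γ t)) w ∧
      HasDerivWithinAt (extChartAt (𝓡∂ n) x₀ ∘ γ) w (Icc 0 1) t ∧
      HasDerivWithinAt (f ∘ γ) (coordDiff f x₀ (extChartAt (𝓡∂ n) x₀ (γ t)) w) (Icc 0 1) t := by
  obtain ⟨-, v, hv, hv'⟩ := isTimelikeCurve_iff.1 hγ t ht
  have hch : γ t ∈ (chartAt (EuclideanHalfSpace n) x₀).source := by
    rwa [extChartAt_source] at hx₀
  have h1 := ((mdifferentiableAt_extChartAt (I := 𝓡∂ n) hch).hasMFDerivAt).comp_hasMFDerivWithinAt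
    t hv
  have h2 := ((hf.mdifferentiableAt (x := γ t) (by simp)).hasMFDerivAt).comp_hasMFDerivWithinAt t hv
  have hfr := frame_mfderiv x₀ hx₀ (v (1 : ℝ))
  refine ⟨_, ?_, HasMFDerivWithinAt.hasDerivWithinAt_vectorSpace h1, ?_⟩
  · refine (CoordTimelike.isFutureTimelike_frame hx₀ _).2 ?_
    have : IsFutureTimelike h f ζ (γ t) (frame x₀ (γ t)
      (mfderiv (𝓡∂ n) 𝓘(ℝ, Model n) (extChartAt (𝓡∂ n) x₀) (γ t) (v (1 : ℝ)))) := by rwa [hfr]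
    exact this
  · convert! HasMFDerivWithinAt.hasDerivWithinAt_vectorSpace h2 using 1
    rw [coordDiff_apply, (extChartAt (𝓡∂ n) x₀).left_inv hx₀]
    exact congrArg (differential f (γ t)) hfr

theorem chron_of_coord {x₀ : M} {c : ℝ → Model n}
    (hc : ∀ t ∈ Icc (0 : ℝ) 1, c t ∈ (extChartAt (𝓡∂ n) x₀).target ∧
      ∃ w, HasDerivWithinAt c w (Icc 0 1) t ∧ CoordTimelike h f ζ x₀ (c t) w) :
    Chron h f ζ (punctured n f) ((extChartAt (𝓡∂ n) x₀).symm (c 0))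
      ((extChartAt (𝓡∂ n) x₀).symm (c 1)) := by
  refine .single ⟨fun t => (extChartAt (𝓡∂ n) x₀).symm (c t), isTimelikeCurve_iff.2 fun t ht => ?_,
    rfl, rfl⟩
  obtain ⟨hct, w, hw, hw'⟩ := hc t ht
  have hT := (coordTimelike_iff h f ζ x₀ hct w).1 hw'
  have h1 := (mdifferentiableWithinAt_extChartAt_symm hct).hasMFDerivWithinAt.comp t
    (hasMFDerivWithinAt_iff_hasFDerivWithinAt.2 hw.hasFDerivWithinAt)
    (fun s hs => extChartAt_target_subset_range x₀ (hc s hs).1)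
  rw [← frame_eq x₀ hct] at h1
  -- A future timelike vector has `df > 0`, so the curve avoids critical points automatically.
  refine ⟨fun h0 => ?_, _, h1, ?_⟩
  · have h2 := hT.2
    rw [differential, h0] at h2
    exact lt_irrefl _ h2
  · have h2 : frame x₀ ((extChartAt (𝓡∂ n) x₀).symm (c t))
        (ContinuousLinearMap.toSpanSingleton ℝ w (1 : ℝ)) =
        frame x₀ ((extChartAt (𝓡∂ n) x₀).symm (c t)) w := by simp
    rw [← h2] at hT
    exact hT

end

/-! ### Openness of the chronological relation and intermediate points -/

section

variable {n : ℕ} [NeZero n] {M : Type*} [TopologicalSpace M]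
  [ChartedSpace (EuclideanHalfSpace n) M] [IsManifold (𝓡∂ n) ∞ M]
  {h : RiemannianMetric n M} {f : M → ℝ} {ζ : ℝ} {U : Set M}

theorem convex_coordBall (x₀ : M) (ρ : ℝ) : Convex ℝ (coordBall (n := n) x₀ ρ) :=
  (convex_ball _ _).inter (𝓡∂ n).convex_range

theorem chron_of_segment {x₀ : M} {u v : Model n} {C : Set (Model n)} (hC : Convex ℝ C)
    (hu : u ∈ C) (hv : v ∈ C) (hsub : C ⊆ (extChartAt (𝓡∂ n) x₀).target)
    (ht : ∀ z ∈ C, CoordTimelike h f ζ x₀ z (v - u)) :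
    Chron h f ζ (punctured n f) ((extChartAt (𝓡∂ n) x₀).symm u)
      ((extChartAt (𝓡∂ n) x₀).symm v) := by
  have hmem : ∀ t ∈ Icc (0 : ℝ) 1, u + t • (v - u) ∈ C := fun t ht =>
    hC.add_smul_sub_mem hu hv ht
  have := chron_of_coord (h := h) (f := f) (ζ := ζ) (x₀ := x₀) (c := fun t : ℝ => u + t • (v - u))
    fun t ht' => ⟨hsub (hmem t ht'), v - u, ?_, ht _ (hmem t ht')⟩
  · simpa using this
  · simpa using (((hasDerivAt_id t).smul_const (v - u)).const_add u).hasDerivWithinAt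

/-- Being timelike is an open condition on point and vector jointly, and invariant under positive
scaling. A coordinate segment whose direction is close to `v₀` after rescaling by `t⁻¹` is therefore
timelike throughout the convex half-ball. -/
theorem exists_chron_of_norm_sub_lt (hf : ContMDiff (𝓡∂ n) 𝓘(ℝ, ℝ) ∞ f) {x₀ : M} {v₀ : Model n}
    (hv₀ : CoordTimelike h f ζ x₀ (extChartAt (𝓡∂ n) x₀ x₀) v₀) :
    ∃ ρ > 0, ∀ u ∈ coordBall (n := n) x₀ ρ, ∀ v ∈ coordBall (n := n) x₀ ρ, ∀ t > 0,
      ‖v - u - t • v₀‖ < t * ρ → Chron h f ζ (punctured n f) ((extChartAt (𝓡∂ n) x₀).symm u)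
        ((extChartAt (𝓡∂ n) x₀).symm v) := by
  have hu₀ := mem_extChartAt_target (I := 𝓡∂ n) x₀
  have htar := extChartAt_target_mem_nhdsWithin (I := 𝓡∂ n) x₀
  have hQ := ((contDiffOn_coordMorse h hf ζ x₀ _ hu₀).mono_of_mem_nhdsWithin
    htar).continuousWithinAt.tendsto
  have hl := ((contDiffOn_coordDiff hf x₀ _ hu₀).mono_of_mem_nhdsWithin
    htar).continuousWithinAt.tendsto
  have h1 : ∀ᶠ z : Model n × Model n in 𝓝[range (𝓡∂ n)] (extChartAt (𝓡∂ n) x₀ x₀) ×ˢ 𝓝 v₀,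
      CoordTimelike h f ζ x₀ z.1 z.2 := by
    have hfst := Filter.tendsto_fst (f := 𝓝[range (𝓡∂ n)] (extChartAt (𝓡∂ n) x₀ x₀)) (g := 𝓝 v₀)
    have hsnd := Filter.tendsto_snd (f := 𝓝[range (𝓡∂ n)] (extChartAt (𝓡∂ n) x₀ x₀)) (g := 𝓝 v₀)
    have c1 := (isBoundedBilinearMap_apply.continuous.tendsto (_, _)).comp
      (((isBoundedBilinearMap_apply.continuous.tendsto (_, _)).comp
        ((hQ.comp hfst).prodMk_nhds hsnd)).prodMk_nhds hsnd)
    have c2 := (isBoundedBilinearMap_apply.continuous.tendsto (_, _)).comp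
      ((hl.comp hfst).prodMk_nhds hsnd)
    exact (c1.eventually (gt_mem_nhds hv₀.1)).and (c2.eventually (lt_mem_nhds hv₀.2))
  obtain ⟨pa, ha, pb, hb, hab⟩ := Filter.eventually_prod_iff.1 h1
  obtain ⟨ρ₁, hρ₁, h₁⟩ := exists_coordBall (x₀ := x₀) (Filter.Eventually.and htar ha)
  obtain ⟨ρ₂, hρ₂, h₂⟩ := Metric.eventually_nhds_iff.1 hb
  refine ⟨min ρ₁ ρ₂, lt_min hρ₁ hρ₂, fun u hu v hv t ht huv => ?_⟩
  have hsub : ∀ z ∈ coordBall (n := n) x₀ (min ρ₁ ρ₂), z ∈ (extChartAt (𝓡∂ n) x₀).target ∧ pa z :=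
    fun z hz => h₁ z (coordBall_mono x₀ (min_le_left _ _) hz)
  refine chron_of_segment (convex_coordBall x₀ _) hu hv (fun z hz => (hsub z hz).1) fun z hz => ?_
  have hw : pb (t⁻¹ • (v - u)) := by
    apply h₂
    have h3 : t⁻¹ • (v - u) - v₀ = t⁻¹ • (v - u - t • v₀) := by
      rw [smul_sub t⁻¹ (v - u), inv_smul_smul₀ ht.ne']
    rw [dist_eq_norm, h3, norm_smul, norm_inv, Real.norm_eq_abs, abs_of_pos ht,
      inv_mul_lt_iff₀ ht]
    exact huv.trans_le (by gcongr; exact min_le_right _ _)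
  have h4 := (hab (hsub z hz).2 hw).smul ht
  rwa [smul_inv_smul₀ ht.ne'] at h4

theorem eventually_mem_coordBall (x₀ : M) {ρ : ℝ} (hρ : 0 < ρ) :
    ∀ᶠ q in 𝓝 x₀, q ∈ (extChartAt (𝓡∂ n) x₀).source ∧
      extChartAt (𝓡∂ n) x₀ q ∈ coordBall (n := n) x₀ ρ := by
  filter_upwards [extChartAt_source_mem_nhds (I := 𝓡∂ n) x₀,
    (continuousAt_extChartAt (I := 𝓡∂ n) x₀).eventually (Metric.ball_mem_nhds _ hρ)] with q hq hq'
  exact ⟨hq, hq', extChartAt_target_subset_range x₀ ((extChartAt (𝓡∂ n) x₀).map_source hq)⟩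

/-- The end of the last curve is replaced by a coordinate segment. Difference quotients at the
endpoint tend to the timelike derivative `v₀`, so the segment from some `γ t` to `γ 1`, and to any
point near it, is timelike; no continuity of the derivative is needed. -/
theorem eventually_chron_right (hf : ContMDiff (𝓡∂ n) 𝓘(ℝ, ℝ) ∞ f) {x y : M}
    (hxy : Chron h f ζ (punctured n f) x y) :
    ∀ᶠ q in 𝓝 y, Chron h f ζ (punctured n f) x q := by
  have key {x y : M} (γ : ℝ → M) (hγ : IsTimelikeCurve h f ζ (punctured n f) γ) (h0 : γ 0 = x)
      (h1 : γ 1 = y) : ∀ᶠ q in 𝓝 y, Chron h f ζ (punctured n f) x q := by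
    subst h0 h1
    set φ := extChartAt (𝓡∂ n) (γ 1) with hφ
    have h11 : (1 : ℝ) ∈ Icc (0 : ℝ) 1 := right_mem_Icc.2 zero_le_one
    obtain ⟨v₀, hv₀, hd, -⟩ := hγ.hasDerivWithinAt_coord hf h11
      (mem_extChartAt_source (I := 𝓡∂ n) (γ 1))
    obtain ⟨ρ, hρ, hall⟩ := exists_chron_of_norm_sub_lt hf hv₀
    have hball := eventually_mem_coordBall (n := n) (γ 1) hρ
    have hslope := hasDerivWithinAt_iff_tendsto_slope.1 hd
    have hle : 𝓝[Ico (0 : ℝ) 1] 1 ≤ 𝓝[Icc 0 1 \ {1}] 1 :=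
      nhdsWithin_mono _ fun t ht => ⟨Ico_subset_Icc_self ht, ht.2.ne⟩
    have e1 : ∀ᶠ t in 𝓝[Ico (0 : ℝ) 1] 1, ‖slope (φ ∘ γ) 1 t - v₀‖ < ρ := by
      have := Metric.tendsto_nhds.1 (hslope.mono_left hle) ρ hρ
      simpa only [dist_eq_norm] using this
    have e2 : ∀ᶠ t in 𝓝[Ico (0 : ℝ) 1] 1, γ t ∈ φ.source ∧
        φ (γ t) ∈ coordBall (n := n) (γ 1) ρ :=
      ((hγ.continuousOn 1 h11).mono Ico_subset_Icc_self).eventually hball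
    have e3 : ∀ᶠ t in 𝓝[Ico (0 : ℝ) 1] 1, (0 : ℝ) < t :=
      nhdsWithin_le_nhds (lt_mem_nhds zero_lt_one)
    have : (𝓝[Ico (0 : ℝ) 1] 1).NeBot := right_nhdsWithin_Ico_neBot zero_lt_one
    obtain ⟨t, ⟨⟨⟨ht1, ht2, ht2'⟩, ht3⟩, ht4⟩⟩ :=
      (((e1.and e2).and e3).and self_mem_nhdsWithin).exists
    have h1t : 0 < 1 - t := by linarith [ht4.2]
    have hlt : ‖φ (γ 1) - φ (γ t) - (1 - t) • v₀‖ < (1 - t) * ρ := by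
      have h3 : φ (γ 1) - φ (γ t) - (1 - t) • v₀ = (1 - t) • (slope (φ ∘ γ) 1 t - v₀) := by
        rw [slope_def_module, smul_sub, smul_smul, ← neg_sub 1 t, inv_neg, mul_neg,
          mul_inv_cancel₀ h1t.ne', neg_one_smul, neg_sub]
        rfl
      rw [h3, norm_smul, Real.norm_eq_abs, abs_of_pos h1t]
      gcongr
    have e4 : ∀ᶠ q in 𝓝 (γ 1), ‖φ q - φ (γ t) - (1 - t) • v₀‖ < (1 - t) * ρ :=
      ((((continuousAt_extChartAt (I := 𝓡∂ n) (γ 1)).sub continuousAt_const).sub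
        continuousAt_const).norm).eventually (gt_mem_nhds hlt)
    filter_upwards [hball, e4] with q ⟨hq1, hq2⟩ hq3
    have h5 := hall _ ht2' _ hq2 (1 - t) h1t hq3
    rw [φ.left_inv ht2, φ.left_inv hq1] at h5
    exact (hγ.chron le_rfl ht3 ht4.2.le).trans h5
  rcases Relation.TransGen.tail'_iff.1 hxy with ⟨b, hxb, γ, hγ, h0, h1⟩
  filter_upwards [key γ hγ h0 h1] with q hq
  exact Relation.TransGen.trans_right hxb hq

theorem punctured_one_sub (hf : ContMDiff (𝓡∂ n) 𝓘(ℝ, ℝ) ∞ f) :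
    criticalSet n (fun x => 1 - f x) = criticalSet n f := by
  ext x
  have := differential_one_sub (n := n) hf x
  change differential (n := n) (fun x => 1 - f x) x = 0 ↔ differential (n := n) f x = 0
  rw [this, neg_eq_zero]

theorem eventually_chron_left (hf : ContMDiff (𝓡∂ n) 𝓘(ℝ, ℝ) ∞ f) {x y : M}
    (hxy : Chron h f ζ (punctured n f) x y) :
    ∀ᶠ q in 𝓝 x, Chron h f ζ (punctured n f) q y := by
  have h1 := chron_one_sub_of_chron hf hxy
  rw [punctured, ← punctured_one_sub hf] at h1
  have h2 := eventually_chron_right (contMDiff_const.sub hf) h1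
  rw [punctured, punctured_one_sub hf] at h2
  filter_upwards [h2] with q hq
  exact (chron_one_sub hf).1 hq

theorem Chron.exists_between_left {x y : M} (hxy : Chron h f ζ U x y) {N : Set M} (hN : N ∈ 𝓝 x) :
    ∃ z ∈ N, Chron h f ζ U x z ∧ Chron h f ζ U z y := by
  obtain ⟨b, ⟨γ, hγ, rfl, rfl⟩, hby⟩ := Relation.TransGen.head'_iff.1 hxy
  have h0 : (0 : ℝ) ∈ Icc (0 : ℝ) 1 := left_mem_Icc.2 zero_le_one
  have e1 : ∀ᶠ t in 𝓝[Ioo (0 : ℝ) 1] 0, γ t ∈ N :=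
    ((hγ.continuousOn 0 h0).mono Ioo_subset_Icc_self).eventually hN
  have : (𝓝[Ioo (0 : ℝ) 1] 0).NeBot := left_nhdsWithin_Ioo_neBot zero_lt_one
  obtain ⟨t, ht, ht'⟩ := (e1.and self_mem_nhdsWithin).exists
  exact ⟨γ t, ht, hγ.chron le_rfl ht'.1 ht'.2.le,
    Relation.TransGen.trans_left (hγ.chron ht'.1.le ht'.2 le_rfl) hby⟩

theorem Chron.exists_between_right (hf : ContMDiff (𝓡∂ n) 𝓘(ℝ, ℝ) ∞ f) {x y : M}
    (hxy : Chron h f ζ U x y) {N : Set M} (hN : N ∈ 𝓝 y) :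
    ∃ z ∈ N, Chron h f ζ U x z ∧ Chron h f ζ U z y := by
  obtain ⟨z, hz, h1, h2⟩ := (chron_one_sub_of_chron hf hxy).exists_between_left hN
  exact ⟨z, hz, (chron_one_sub hf).1 h2, (chron_one_sub hf).1 h1⟩

theorem Chron.lt (hf : ContMDiff (𝓡∂ n) 𝓘(ℝ, ℝ) ∞ f) {x y : M} (hxy : Chron h f ζ U x y) :
    f x < f y := by
  induction hxy with
  | single H =>
    obtain ⟨γ, hγ, rfl, rfl⟩ := H
    exact hγ.strictMonoOn hf (left_mem_Icc.2 zero_le_one) (right_mem_Icc.2 zero_le_one) zero_lt_one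
  | tail _ H ih =>
    obtain ⟨γ, hγ, rfl, rfl⟩ := H
    exact ih.trans (hγ.strictMonoOn hf (left_mem_Icc.2 zero_le_one)
      (right_mem_Icc.2 zero_le_one) zero_lt_one)

theorem Chron.left_mem {x y : M} (hxy : Chron h f ζ U x y) : x ∈ U := by
  obtain ⟨b, ⟨γ, hγ, rfl, rfl⟩, -⟩ := Relation.TransGen.head'_iff.1 hxy
  exact (hγ 0 (left_mem_Icc.2 zero_le_one)).1

theorem Chron.right_mem {x y : M} (hxy : Chron h f ζ U x y) : y ∈ U := by
  obtain ⟨b, -, γ, hγ, rfl, rfl⟩ := Relation.TransGen.tail'_iff.1 hxy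
  exact (hγ 1 (right_mem_Icc.2 zero_le_one)).1

theorem Chron.exists_level (hf : ContMDiff (𝓡∂ n) 𝓘(ℝ, ℝ) ∞ f) {x y : M}
    (hxy : Chron h f ζ U x y) {b : ℝ} (hx : f x < b) (hy : b < f y) :
    ∃ z, f z = b ∧ Chron h f ζ U x z ∧ Chron h f ζ U z y := by
  have key (γ : ℝ → M) (hγ : IsTimelikeCurve h f ζ U γ) (h0 : f (γ 0) < b) (h1 : b < f (γ 1)) :
      ∃ z, f z = b ∧ Chron h f ζ U (γ 0) z ∧ Chron h f ζ U z (γ 1) := by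
    obtain ⟨t, ht, htb⟩ := intermediate_value_Icc zero_le_one
      (hf.continuous.comp_continuousOn hγ.continuousOn) ⟨h0.le, h1.le⟩
    have htb' : f (γ t) = b := htb
    refine ⟨γ t, htb, hγ.chron le_rfl (ht.1.lt_of_ne ?_) ht.2,
      hγ.chron ht.1 (ht.2.lt_of_ne ?_) le_rfl⟩
    · rintro rfl; linarith
    · rintro rfl; linarith
  induction hxy using Relation.TransGen.head_induction_on with
  | single H =>
    obtain ⟨γ, hγ, rfl, rfl⟩ := H
    exact key γ hγ hx hy
  | head H hcy ih =>
    obtain ⟨γ, hγ, rfl, rfl⟩ := H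
    rcases lt_trichotomy (f (γ 1)) b with hb | hb | hb
    · obtain ⟨z, hz, h1, h2⟩ := ih hb
      exact ⟨z, hz, .head ⟨γ, hγ, rfl, rfl⟩ h1, h2⟩
    · exact ⟨γ 1, hb, .single ⟨γ, hγ, rfl, rfl⟩, hcy⟩
    · obtain ⟨z, hz, h1, h2⟩ := key γ hγ hx hb
      exact ⟨z, hz, h1, h2.trans hcy⟩

theorem ConeBounds.chron_add {x₀ : M} {ρ K κ L : ℝ} {e : Model n}
    (cb : ConeBounds h f ζ x₀ ρ K κ L e) {u : Model n} {t : ℝ} (ht : 0 < t)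
    (hu : u ∈ coordBall (n := n) x₀ ρ) (hut : u + t • e ∈ coordBall (n := n) x₀ ρ) :
    Chron h f ζ (punctured n f) ((extChartAt (𝓡∂ n) x₀).symm u)
      ((extChartAt (𝓡∂ n) x₀).symm (u + t • e)) := by
  refine chron_of_segment (convex_coordBall x₀ ρ) hu hut cb.subset_target fun z hz => ?_
  rw [add_sub_cancel_left]
  exact (cb.timelike z hz).smul ht

theorem exists_chron_mem (hf : ContMDiff (𝓡∂ n) 𝓘(ℝ, ℝ) ∞ f) (hζ : 1 < ζ) {x : M}
    (hx : x ∉ criticalSet n f) (hx' : (𝓡∂ n).IsInteriorPoint x) {N : Set M} (hN : N ∈ 𝓝 x) :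
    ∃ s ∈ N, Chron h f ζ (punctured n f) x s := by
  obtain ⟨ρ, K, κ, L, e, cb⟩ := exists_coneBounds h hf hζ hx
  have hc : Filter.Tendsto (fun t : ℝ => extChartAt (𝓡∂ n) x x + t • e) (𝓝[>] 0)
      (𝓝 (extChartAt (𝓡∂ n) x x)) := by
    have : Continuous fun t : ℝ => extChartAt (𝓡∂ n) x x + t • e := by fun_prop
    simpa using (this.tendsto 0).mono_left nhdsWithin_le_nhds
  have e1 : ∀ᶠ t in 𝓝[>] (0 : ℝ), (extChartAt (𝓡∂ n) x).symm (extChartAt (𝓡∂ n) x x + t • e) ∈ N :=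
    hc.eventually ((continuousAt_extChartAt_symm x).eventually (by rwa [extChartAt_to_inv]))
  have e2 := hc.eventually (Filter.inter_mem (Metric.ball_mem_nhds _ cb.rho_pos)
    (range_mem_nhds_isInteriorPoint hx'))
  obtain ⟨t, ⟨ht1, ht2⟩, ht3⟩ := ((e1.and e2).and self_mem_nhdsWithin).exists
  refine ⟨_, ht1, ?_⟩
  have := cb.chron_add ht3 ⟨Metric.mem_ball_self cb.rho_pos, mem_range_self _⟩ ht2
  rwa [extChartAt_to_inv] at this

end

/-! ### Confinement and backward shift of timelike curves in a chart -/

section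

variable {n : ℕ} [NeZero n] {M : Type*} [TopologicalSpace M]
  [ChartedSpace (EuclideanHalfSpace n) M] [IsManifold (𝓡∂ n) ∞ M]
  {h : RiemannianMetric n M} {f : M → ℝ} {ζ : ℝ} {U : Set M}
  {x₀ : M} {ρ K κ L : ℝ} {e : Model n}

/-- The coordinate speed is at most `K` times the derivative of `f ∘ γ`; the mean value inequality
turns this into a bound on displacement. -/
theorem ConeBounds.norm_sub_le (cb : ConeBounds h f ζ x₀ ρ K κ L e)
    (hf : ContMDiff (𝓡∂ n) 𝓘(ℝ, ℝ) ∞ f) {γ : ℝ → M} (hγ : IsTimelikeCurve h f ζ U γ) {t : ℝ}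
    (ht : t ∈ Icc (0 : ℝ) 1) (hmem : ∀ s ∈ Icc t 1, γ s ∈ (extChartAt (𝓡∂ n) x₀).source ∧
      extChartAt (𝓡∂ n) x₀ (γ s) ∈ Metric.ball (extChartAt (𝓡∂ n) x₀ x₀) ρ) :
    ‖extChartAt (𝓡∂ n) x₀ (γ t) - extChartAt (𝓡∂ n) x₀ (γ 1)‖ ≤ K * (f (γ 1) - f (γ t)) := by
  set φ := extChartAt (𝓡∂ n) x₀ with hφ
  have hsub : Icc t 1 ⊆ Icc (0 : ℝ) 1 := Icc_subset_Icc_left ht.1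
  have H : ∀ s ∈ Icc t 1, ∃ w, ‖w‖ ≤ K * coordDiff f x₀ (φ (γ s)) w ∧
      HasDerivWithinAt (φ ∘ γ) w (Icc 0 1) s ∧
      HasDerivWithinAt (f ∘ γ) (coordDiff f x₀ (φ (γ s)) w) (Icc 0 1) s := fun s hs => by
    obtain ⟨w, hw, h1, h2⟩ := hγ.hasDerivWithinAt_coord hf (hsub hs) (hmem s hs).1
    exact ⟨w, cb.norm_le _ ⟨(hmem s hs).2, extChartAt_target_subset_range x₀
      (φ.map_source (hmem s hs).1)⟩ w hw, h1, h2⟩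
  choose! w hw h1 h2 using H
  have hmono : ∀ s ∈ Ico t 1, Icc (0 : ℝ) 1 ∈ 𝓝[Ici s] s := fun s hs =>
    Filter.mem_of_superset (Icc_mem_nhdsGE hs.2) (Icc_subset_Icc_left (ht.1.trans hs.1))
  have key := image_norm_le_of_norm_deriv_right_le_deriv_boundary' (a := t) (b := 1)
    (f := fun s => φ (γ s) - φ (γ t)) (f' := w) (B := fun s => K * (f (γ s) - f (γ t)))
    (B' := fun s => K * coordDiff f x₀ (φ (γ s)) (w s))
    (fun s hs => (((h1 s hs).continuousWithinAt.mono hsub).sub continuousWithinAt_const))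
    (fun s hs => ((h1 s (Ico_subset_Icc_self hs)).mono_of_mem_nhdsWithin (hmono s hs)).sub_const _)
    (by simp)
    (fun s hs => ((h2 s hs).continuousWithinAt.mono hsub).sub continuousWithinAt_const
      |>.const_mul K)
    (fun s hs => (((h2 s (Ico_subset_Icc_self hs)).mono_of_mem_nhdsWithin
      (hmono s hs)).sub_const _).const_mul K)
    (fun s hs => hw s (Ico_subset_Icc_self hs)) (right_mem_Icc.2 ht.2)
  rwa [norm_sub_rev] at key

/-- Consider the last time the curve is outside the open ball. After it, the displacement bound
keeps the curve in a strictly smaller closed ball, hence also at that time in the limit: a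
contradiction. -/
theorem ConeBounds.confined [T2Space M] (cb : ConeBounds h f ζ x₀ ρ K κ L e)
    (hf : ContMDiff (𝓡∂ n) 𝓘(ℝ, ℝ) ∞ f) {γ : ℝ → M} (hγ : IsTimelikeCurve h f ζ U γ) {r : ℝ}
    (hr : r ≤ ρ) (h1 : γ 1 ∈ (extChartAt (𝓡∂ n) x₀).source)
    (hlt : ‖extChartAt (𝓡∂ n) x₀ (γ 1) - extChartAt (𝓡∂ n) x₀ x₀‖ +
      K * (f (γ 1) - f (γ 0)) < r) :
    ∀ t ∈ Icc (0 : ℝ) 1, γ t ∈ (extChartAt (𝓡∂ n) x₀).source ∧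
      extChartAt (𝓡∂ n) x₀ (γ t) ∈ Metric.ball (extChartAt (𝓡∂ n) x₀ x₀) r := by
  set φ := extChartAt (𝓡∂ n) x₀ with hφ
  have hmono := (hγ.strictMonoOn hf).monotoneOn
  have h00 : (0 : ℝ) ∈ Icc (0 : ℝ) 1 := left_mem_Icc.2 zero_le_one
  have h11 : (1 : ℝ) ∈ Icc (0 : ℝ) 1 := right_mem_Icc.2 zero_le_one
  set O : Set M := φ.source ∩ φ ⁻¹' Metric.ball (φ x₀) r with hO
  have hOo : IsOpen O := isOpen_extChartAt_preimage' x₀ Metric.isOpen_ball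
  have hO1 : γ 1 ∈ O := by
    refine ⟨h1, mem_ball_iff_norm.2 (lt_of_le_of_lt ?_ hlt)⟩
    have := hmono h00 h11 zero_le_one
    exact le_add_of_nonneg_right (mul_nonneg cb.K_pos.le (sub_nonneg.2 this))
  by_contra hcon
  push Not at hcon
  obtain ⟨t₁, ht₁, hbad⟩ := hcon
  have hclosed : IsClosed (Icc 0 1 ∩ γ ⁻¹' Oᶜ) :=
    hγ.continuousOn.preimage_isClosed_of_isClosed isClosed_Icc hOo.isClosed_compl
  have hcomp : IsCompact (Icc 0 1 ∩ γ ⁻¹' Oᶜ) :=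
    isCompact_Icc.of_isClosed_subset hclosed inter_subset_left
  obtain ⟨t, ⟨ht, htO⟩, hmax⟩ := hcomp.exists_isGreatest
    ⟨t₁, ht₁, fun hmem => hbad hmem.1 hmem.2⟩
  have ht1 : t < 1 := ht.2.lt_of_ne (by rintro rfl; exact htO hO1)
  have hin : ∀ s ∈ Ioc t 1, γ s ∈ O := fun s hs => by
    by_contra hsO
    exact absurd (hmax ⟨⟨ht.1.trans hs.1.le, hs.2⟩, hsO⟩) (not_le.2 hs.1)
  set r' := ‖φ (γ 1) - φ x₀‖ + K * (f (γ 1) - f (γ 0)) with hr'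
  have hCsub : Metric.closedBall (φ x₀) r' ∩ range (𝓡∂ n) ⊆ φ.target := fun u hu =>
    cb.subset_target ⟨Metric.closedBall_subset_ball (hlt.trans_le hr) hu.1, hu.2⟩
  -- Closedness in `M`, from compactness and the Hausdorff property, ensures that the limit point
  -- does not leave the chart domain.
  have hC : IsClosed (φ.symm '' (Metric.closedBall (φ x₀) r' ∩ range (𝓡∂ n))) :=
    (((isCompact_closedBall _ _).inter_right (𝓡∂ n).isClosed_range).image_of_continuousOn
      ((continuousOn_extChartAt_symm x₀).mono hCsub)).isClosed
  have hinC : ∀ s ∈ Ioc t 1,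
      γ s ∈ φ.symm '' (Metric.closedBall (φ x₀) r' ∩ range (𝓡∂ n)) := fun s hs => by
    have hs01 : s ∈ Icc (0 : ℝ) 1 := ⟨ht.1.trans hs.1.le, hs.2⟩
    have hb := cb.norm_sub_le hf hγ hs01 fun s' hs' => by
      have := hin s' ⟨hs.1.trans_le hs'.1, hs'.2⟩
      exact ⟨this.1, Metric.ball_subset_ball hr this.2⟩
    refine ⟨φ (γ s), ⟨?_, extChartAt_target_subset_range x₀ (φ.map_source (hin s hs).1)⟩,
      φ.left_inv (hin s hs).1⟩
    rw [mem_closedBall_iff_norm]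
    have h0s : f (γ 0) ≤ f (γ s) := hmono h00 hs01 hs01.1
    calc ‖φ (γ s) - φ x₀‖
      _ ≤ ‖φ (γ s) - φ (γ 1)‖ + ‖φ (γ 1) - φ x₀‖ := norm_sub_le_norm_sub_add_norm_sub _ _ _
      _ ≤ K * (f (γ 1) - f (γ s)) + ‖φ (γ 1) - φ x₀‖ := by gcongr
      _ ≤ K * (f (γ 1) - f (γ 0)) + ‖φ (γ 1) - φ x₀‖ := by
        have := cb.K_pos
        gcongr
      _ = r' := add_comm _ _
  have : (𝓝[Ioc t 1] t).NeBot := left_nhdsWithin_Ioc_neBot ht1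
  obtain ⟨u, hu, hut⟩ := hC.mem_of_tendsto
    ((hγ.continuousOn t ht).mono (fun s hs => ⟨ht.1.trans hs.1.le, hs.2⟩ : Ioc t 1 ⊆ Icc 0 1))
    (Filter.eventually_of_mem self_mem_nhdsWithin hinC)
  apply htO
  rw [← hut]
  refine ⟨φ.map_target (hCsub hu), ?_⟩
  rw [mem_preimage, φ.right_inv (hCsub hu)]
  exact Metric.closedBall_subset_ball hlt hu.1

/-- With `η = σ exp(-Λ f)`, the derivative of `-η e` along the curve is `Λ η df(w) e`, precisely the
tilt required by `timelike_shift`. The bound `f ≥ 0` gives `η ≤ σ`. -/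
theorem ConeBounds.chron_shift_of_curve (cb : ConeBounds h f ζ x₀ ρ K κ L e)
    (hf : ContMDiff (𝓡∂ n) 𝓘(ℝ, ℝ) ∞ f) (hf0 : ∀ x, 0 ≤ f x)
    (hball : Metric.ball (extChartAt (𝓡∂ n) x₀ x₀) ρ ⊆ range (𝓡∂ n)) {Λ σ : ℝ} (hΛ : 0 ≤ Λ)
    (hΛ' : 2 * L * K ^ 2 * ‖e‖ ≤ Λ * κ) (hσ : 0 ≤ σ) (hσK : Λ * σ * ‖e‖ ≤ K)
    (hσρ : σ * ‖e‖ ≤ ρ / 2) {γ : ℝ → M} (hγ : IsTimelikeCurve h f ζ U γ)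
    (hmem : ∀ t ∈ Icc (0 : ℝ) 1, γ t ∈ (extChartAt (𝓡∂ n) x₀).source ∧
      extChartAt (𝓡∂ n) x₀ (γ t) ∈ Metric.ball (extChartAt (𝓡∂ n) x₀ x₀) (ρ / 2)) :
    Chron h f ζ (punctured n f)
      ((extChartAt (𝓡∂ n) x₀).symm (extChartAt (𝓡∂ n) x₀ (γ 0) -
        (σ * Real.exp (-(Λ * f (γ 0)))) • e))
      ((extChartAt (𝓡∂ n) x₀).symm (extChartAt (𝓡∂ n) x₀ (γ 1) -
        (σ * Real.exp (-(Λ * f (γ 1)))) • e)) := by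
  set φ := extChartAt (𝓡∂ n) x₀ with hφ
  refine chron_of_coord (c := fun t => φ (γ t) - (σ * Real.exp (-(Λ * f (γ t)))) • e)
    fun t ht => ?_
  have hexp : Real.exp (-(Λ * f (γ t))) ≤ 1 :=
    Real.exp_le_one_iff.2 (neg_nonpos.2 (mul_nonneg hΛ (hf0 _)))
  have hη : σ * Real.exp (-(Λ * f (γ t))) ≤ σ := mul_le_of_le_one_right hσ hexp
  have hη0 : 0 ≤ σ * Real.exp (-(Λ * f (γ t))) := by positivity
  have hb1 : φ (γ t) ∈ Metric.ball (φ x₀) ρ :=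
    Metric.ball_subset_ball (by linarith [cb.rho_pos]) (hmem t ht).2
  have hb2 : φ (γ t) - (σ * Real.exp (-(Λ * f (γ t)))) • e ∈ Metric.ball (φ x₀) ρ := by
    have h1 := mem_ball_iff_norm.1 (hmem t ht).2
    rw [mem_ball_iff_norm, sub_right_comm]
    calc _ ≤ ‖φ (γ t) - φ x₀‖ + ‖(σ * Real.exp (-(Λ * f (γ t)))) • e‖ := _root_.norm_sub_le _ _
      _ ≤ ‖φ (γ t) - φ x₀‖ + σ * ‖e‖ := by
        rw [norm_smul, Real.norm_eq_abs, abs_of_nonneg hη0]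
        gcongr
      _ < ρ := by linarith
  obtain ⟨w, hw, h1, h2⟩ := hγ.hasDerivWithinAt_coord hf ht (hmem t ht).1
  refine ⟨cb.subset_target ⟨hb2, hball hb2⟩,
    w + (Λ * (σ * Real.exp (-(Λ * f (γ t)))) * coordDiff f x₀ (φ (γ t)) w) • e, ?_, ?_⟩
  · have h3 := h1.sub ((((h2.const_mul Λ).neg.exp).const_mul σ).smul_const e)
    convert! h3 using 1
    rw [sub_eq_add_neg, ← neg_smul]
    congr 2
    simp only [Function.comp, Pi.neg_apply, hφ]
    ring
  · refine cb.timelike_shift ⟨hb1, hball hb1⟩ ⟨hb2, hball hb2⟩ hη0 hΛ ?_ hΛ' hw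
    refine le_trans ?_ hσK
    gcongr

/-- `Chron` is a chain of curves, treated backwards from `s`. The quantity `‖φ p - φ x₀‖ + K (f p -
m)`, with `φ` the chart, does not increase from the end of a curve to its start, so the smallness
assumption passes to each earlier link. -/
theorem ConeBounds.chron_shift [T2Space M] (cb : ConeBounds h f ζ x₀ ρ K κ L e)
    (hf : ContMDiff (𝓡∂ n) 𝓘(ℝ, ℝ) ∞ f) (hf0 : ∀ x, 0 ≤ f x)
    (hball : Metric.ball (extChartAt (𝓡∂ n) x₀ x₀) ρ ⊆ range (𝓡∂ n)) {Λ : ℝ} (hΛ : 0 ≤ Λ)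
    (hΛ' : 2 * L * K ^ 2 * ‖e‖ ≤ Λ * κ) {p s : M} (hps : Chron h f ζ U p s) {m : ℝ}
    (hm : m ≤ f p) (hs : s ∈ (extChartAt (𝓡∂ n) x₀).source)
    (hlt : ‖extChartAt (𝓡∂ n) x₀ s - extChartAt (𝓡∂ n) x₀ x₀‖ + K * (f s - m) < ρ / 2) :
    (p ∈ (extChartAt (𝓡∂ n) x₀).source ∧
      ‖extChartAt (𝓡∂ n) x₀ p - extChartAt (𝓡∂ n) x₀ x₀‖ + K * (f p - m) < ρ / 2) ∧
    ∀ σ, 0 ≤ σ → Λ * σ * ‖e‖ ≤ K → σ * ‖e‖ ≤ ρ / 2 →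
      Chron h f ζ (punctured n f)
        ((extChartAt (𝓡∂ n) x₀).symm (extChartAt (𝓡∂ n) x₀ p -
          (σ * Real.exp (-(Λ * f p))) • e))
        ((extChartAt (𝓡∂ n) x₀).symm (extChartAt (𝓡∂ n) x₀ s -
          (σ * Real.exp (-(Λ * f s))) • e)) := by
  have hρ : ρ / 2 ≤ ρ := by linarith [cb.rho_pos]
  have key (γ : ℝ → M) (hγ : IsTimelikeCurve h f ζ U γ) (hm : m ≤ f (γ 0))
      (h1 : γ 1 ∈ (extChartAt (𝓡∂ n) x₀).source)
      (hlt : ‖extChartAt (𝓡∂ n) x₀ (γ 1) - extChartAt (𝓡∂ n) x₀ x₀‖ + K * (f (γ 1) - m) < ρ / 2) :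
      (γ 0 ∈ (extChartAt (𝓡∂ n) x₀).source ∧
        ‖extChartAt (𝓡∂ n) x₀ (γ 0) - extChartAt (𝓡∂ n) x₀ x₀‖ + K * (f (γ 0) - m) < ρ / 2) ∧
      ∀ t ∈ Icc (0 : ℝ) 1, γ t ∈ (extChartAt (𝓡∂ n) x₀).source ∧
        extChartAt (𝓡∂ n) x₀ (γ t) ∈ Metric.ball (extChartAt (𝓡∂ n) x₀ x₀) (ρ / 2) := by
    have h00 : (0 : ℝ) ∈ Icc (0 : ℝ) 1 := left_mem_Icc.2 zero_le_one
    have hK := cb.K_pos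
    have hc := cb.confined hf hγ hρ h1 (lt_of_le_of_lt (by gcongr) hlt)
    refine ⟨⟨(hc 0 h00).1, ?_⟩, hc⟩
    have hb := cb.norm_sub_le hf hγ h00 fun s hs =>
      ⟨(hc s hs).1, Metric.ball_subset_ball hρ (hc s hs).2⟩
    have := norm_sub_le_norm_sub_add_norm_sub (extChartAt (𝓡∂ n) x₀ (γ 0))
      (extChartAt (𝓡∂ n) x₀ (γ 1)) (extChartAt (𝓡∂ n) x₀ x₀)
    linarith
  induction hps using Relation.TransGen.head_induction_on with
  | single H =>
    obtain ⟨γ, hγ, rfl, rfl⟩ := H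
    obtain ⟨h1, h2⟩ := key γ hγ hm hs hlt
    exact ⟨h1, fun σ h3 h4 h5 => cb.chron_shift_of_curve hf hf0 hball hΛ hΛ' h3 h4 h5 hγ h2⟩
  | head H hcs ih =>
    obtain ⟨γ, hγ, rfl, rfl⟩ := H
    have hm' : m ≤ f (γ 1) := hm.trans (hγ.strictMonoOn hf (left_mem_Icc.2 zero_le_one)
      (right_mem_Icc.2 zero_le_one) zero_lt_one).le
    obtain ⟨⟨h6, h7⟩, h8⟩ := ih hm'
    obtain ⟨h1, h2⟩ := key γ hγ hm h6 h7
    exact ⟨h1, fun σ h3 h4 h5 =>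
      (cb.chron_shift_of_curve hf hf0 hball hΛ hΛ' h3 h4 h5 hγ h2).trans (h8 σ h3 h4 h5)⟩

end

/-! ### Push-up near a regular level, and its union over overlapping slabs -/

section

variable {n : ℕ} [NeZero n] {M : Type*} [TopologicalSpace M]
  [ChartedSpace (EuclideanHalfSpace n) M] [IsManifold (𝓡∂ n) ∞ M]
  {h : RiemannianMetric n M} {f : M → ℝ} {ζ : ℝ}

theorem Chron.trans {U : Set M} {x y z : M} (hxy : Chron h f ζ U x y) (hyz : Chron h f ζ U y z) :
    Chron h f ζ U x z :=
  Relation.TransGen.trans hxy hyz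

theorem ConeBounds.mono {x₀ : M} {ρ ρ' K κ L : ℝ} {e : Model n}
    (cb : ConeBounds h f ζ x₀ ρ K κ L e) (hρ : 0 < ρ') (hle : ρ' ≤ ρ) :
    ConeBounds h f ζ x₀ ρ' K κ L e :=
  have hs := coordBall_mono (n := n) x₀ hle
  ⟨hρ, cb.K_pos, cb.kappa_pos, cb.L_nonneg, hs.trans cb.subset_target,
    fun u hu => cb.norm_le u (hs hu), fun u hu => cb.morse_le u (hs hu),
    fun u hu => cb.timelike u (hs hu), fun u hu u' hu' => cb.lipschitz u (hs hu) u' (hs hu'),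
    fun u hu u' hu' => cb.osc u (hs hu) u' (hs hu')⟩

theorem exists_pushUp_nhds [T2Space M] (hf : ContMDiff (𝓡∂ n) 𝓘(ℝ, ℝ) ∞ f)
    (hf01 : ∀ x, f x ∈ Icc (0 : ℝ) 1) (hζ : 1 < ζ) {x₀ : M} (hx₀ : x₀ ∉ criticalSet n f)
    (hx₀' : (𝓡∂ n).IsInteriorPoint x₀) :
    ∃ ε > 0, ∀ᶠ x in 𝓝 x₀, ∀ y y', f x - ε < f y → Chron h f ζ (punctured n f) y y' →
      (∀ s, Chron h f ζ (punctured n f) x s → Chron h f ζ (punctured n f) y' s) →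
      Chron h f ζ (punctured n f) y x := by
  obtain ⟨ρ₀, K, κ, L, e, cb₀⟩ := exists_coneBounds h hf hζ hx₀
  obtain ⟨ρ₁, hρ₁, hball₁⟩ := Metric.mem_nhds_iff.1 (range_mem_nhds_isInteriorPoint hx₀')
  set ρ := min ρ₀ ρ₁ with hρdef
  have cb := cb₀.mono (lt_min cb₀.rho_pos hρ₁) (min_le_left ρ₀ ρ₁)
  rw [← hρdef] at cb
  set φ := extChartAt (𝓡∂ n) x₀ with hφ
  have hball : Metric.ball (φ x₀) ρ ⊆ range (𝓡∂ n) :=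
    (Metric.ball_subset_ball (min_le_right _ _)).trans hball₁
  have hρ := cb.rho_pos
  have hK := cb.K_pos
  have hκ := cb.kappa_pos
  have hL := cb.L_nonneg
  have htar : ∀ u ∈ Metric.ball (φ x₀) ρ, u ∈ φ.target := fun u hu => cb.subset_target ⟨hu, hball hu⟩
  set Λ := 2 * L * K ^ 2 * ‖e‖ / κ with hΛdef
  have hΛ : 0 ≤ Λ := by positivity
  have hΛ' : 2 * L * K ^ 2 * ‖e‖ ≤ Λ * κ := (div_mul_cancel₀ _ hκ.ne').ge
  -- The drop of `f` then costs at most `ρ / 8` in displacement, and `x` lies within `ρ / 8` of the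
  -- centre: the total is below `ρ / 2`.
  refine ⟨ρ / (8 * K), by positivity, ?_⟩
  filter_upwards [eventually_mem_coordBall (n := n) x₀ (ρ := ρ / 8) (by positivity)]
    with x ⟨hxs, hxb, _⟩ y y' hy hyy' hR
  have hxb' := mem_ball_iff_norm.1 hxb
  have hxt : φ x ∈ φ.target := φ.map_source hxs
  have hxρ : φ x ∈ Metric.ball (φ x₀) ρ := Metric.ball_subset_ball (by linarith) hxb
  -- points just to the future of `x`
  have hc : Filter.Tendsto (fun t : ℝ => φ x + t • e) (𝓝[>] 0) (𝓝 (φ x)) := by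
    have : Continuous fun t : ℝ => φ x + t • e := by fun_prop
    simpa using (this.tendsto 0).mono_left nhdsWithin_le_nhds
  have hcs : Filter.Tendsto (fun t : ℝ => f (φ.symm (φ x + t • e))) (𝓝[>] 0) (𝓝 (f x)) := by
    have h1 := (hf.continuous.continuousAt.comp (continuousAt_extChartAt_symm'' hxt)).tendsto.comp hc
    simpa only [Function.comp_def, ← hφ, φ.left_inv hxs] using h1
  have hg : Filter.Tendsto (fun t : ℝ => ‖φ x + t • e - φ x₀‖ +
      K * (f (φ.symm (φ x + t • e)) - f y)) (𝓝[>] 0) (𝓝 (‖φ x - φ x₀‖ + K * (f x - f y))) :=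
    (hc.sub_const _).norm.add ((hcs.sub_const _).const_mul K)
  have hg0 : ‖φ x - φ x₀‖ + K * (f x - f y) < ρ / 2 := by
    have h1 : K * (f x - f y) ≤ K * (ρ / (8 * K)) := by gcongr; linarith
    have h2 : K * (ρ / (8 * K)) = ρ / 8 := by field_simp
    linarith
  have hgood : ∀ᶠ t : ℝ in 𝓝[>] 0, 0 < t ∧ φ x + t • e ∈ Metric.ball (φ x₀) ρ ∧
      ‖φ x + t • e - φ x₀‖ + K * (f (φ.symm (φ x + t • e)) - f y) < ρ / 2 :=
    (show ∀ᶠ t : ℝ in 𝓝[>] 0, 0 < t from self_mem_nhdsWithin).and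
      ((hc.eventually (Metric.isOpen_ball.mem_nhds hxρ)).and (hg.eventually (gt_mem_nhds hg0)))
  have hshift : ∀ t : ℝ, 0 < t → φ x + t • e ∈ Metric.ball (φ x₀) ρ →
      ‖φ x + t • e - φ x₀‖ + K * (f (φ.symm (φ x + t • e)) - f y) < ρ / 2 → _ :=
    fun t ht0 htb htg => by
      have hxs' : Chron h f ζ (punctured n f) x (φ.symm (φ x + t • e)) := by
        have h1 := cb.chron_add ht0 ⟨hxρ, hball hxρ⟩ ⟨htb, hball htb⟩
        rwa [← hφ, φ.left_inv hxs] at h1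
      have htt := htar _ htb
      exact cb.chron_shift hf (fun x => (hf01 x).1) hball hΛ hΛ' (hR _ hxs') (hyy'.lt hf).le
        (φ.map_target htt) (by rw [← hφ, φ.right_inv htt]; exact htg)
  obtain ⟨t₀, ht₀, ht₀b, ht₀g⟩ := hgood.exists
  have hy's : y' ∈ φ.source := (hshift t₀ ht₀ ht₀b ht₀g).1.1
  have hσ1 : Filter.Tendsto (fun σ : ℝ => φ.symm (φ y' - (σ * Real.exp (-(Λ * f y'))) • e))
      (𝓝[>] 0) (𝓝 y') := by
    have h1 : Continuous fun σ : ℝ => φ y' - (σ * Real.exp (-(Λ * f y'))) • e := by fun_prop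
    have h2 : Filter.Tendsto (fun σ : ℝ => φ y' - (σ * Real.exp (-(Λ * f y'))) • e)
        (𝓝[>] 0) (𝓝 (φ y')) := by
      simpa using (h1.tendsto 0).mono_left nhdsWithin_le_nhds
    have h3 := (continuousAt_extChartAt_symm' (I := 𝓡∂ n) hy's).tendsto.comp h2
    rwa [← hφ, φ.left_inv hy's] at h3
  have hσ2 : ∀ᶠ σ : ℝ in 𝓝[>] 0, Λ * σ * ‖e‖ < K := by
    have h1 : Continuous fun σ : ℝ => Λ * σ * ‖e‖ := by fun_prop
    exact nhdsWithin_le_nhds ((h1.tendsto 0).eventually (gt_mem_nhds (by simpa using hK)))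
  have hσ3 : ∀ᶠ σ : ℝ in 𝓝[>] 0, σ * ‖e‖ < ρ / 4 := by
    have h1 : Continuous fun σ : ℝ => σ * ‖e‖ := by fun_prop
    exact nhdsWithin_le_nhds ((h1.tendsto 0).eventually (gt_mem_nhds (by simpa using hρ)))
  -- The shift `σ` is fixed first, so small that the shifted `y'` is still in `I⁺(y)`. Afterwards
  -- `t` is taken below `σ exp(-Λ)`, a lower bound for the shift at the other end since `f ≤ 1`; so
  -- the shifted curve ends before `x`.
  obtain ⟨σ, ⟨⟨hyσ, hσK⟩, hσρ⟩, hσ0⟩ :=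
    (((hσ1.eventually (eventually_chron_right hf hyy')).and hσ2).and hσ3).and
      self_mem_nhdsWithin |>.exists
  have hσ0 : 0 < σ := hσ0
  have hsmall : ∀ᶠ t : ℝ in 𝓝[>] 0, t < σ * Real.exp (-Λ) :=
    nhdsWithin_le_nhds (gt_mem_nhds (by positivity))
  obtain ⟨t, ⟨ht0, htb, htg⟩, htσ⟩ := (hgood.and hsmall).exists
  have h1 := (hshift t ht0 htb htg).2 σ hσ0.le hσK.le (by linarith)
  rw [← hφ, φ.right_inv (htar _ htb)] at h1
  set η := σ * Real.exp (-(Λ * f (φ.symm (φ x + t • e)))) with hη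
  have hηt : t < η := by
    refine htσ.trans_le ?_
    rw [hη]
    gcongr
    exact mul_le_of_le_one_right hΛ (hf01 _).2
  have hησ : η ≤ σ := mul_le_of_le_one_right hσ0.le
    (Real.exp_le_one_iff.2 (neg_nonpos.2 (mul_nonneg hΛ (hf01 _).1)))
  have hv : φ x + t • e - η • e ∈ Metric.ball (φ x₀) ρ := by
    have h2 : φ x + t • e - η • e - φ x₀ = (φ x - φ x₀) - (η - t) • e := by
      rw [sub_smul]; abel
    rw [mem_ball_iff_norm, h2]
    calc _ ≤ ‖φ x - φ x₀‖ + ‖(η - t) • e‖ := _root_.norm_sub_le _ _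
      _ ≤ ‖φ x - φ x₀‖ + σ * ‖e‖ := by
        rw [norm_smul, Real.norm_eq_abs, abs_of_pos (sub_pos.2 hηt)]
        gcongr
        linarith
      _ < ρ := by linarith
  have hvx : φ x + t • e - η • e + (η - t) • e = φ x := by rw [sub_smul]; abel
  have h2 := cb.chron_add (u := φ x + t • e - η • e) (sub_pos.2 hηt) ⟨hv, hball hv⟩
    (by rw [hvx]; exact ⟨hxρ, hball hxρ⟩)
  rw [hvx, ← hφ, φ.left_inv hxs] at h2
  exact (hyσ.trans h1).trans h2

/-- Between the levels `a` and `b`, a point with a future point in the common past of `I⁺(x)`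
precedes `x`. -/
def PushUp (h : RiemannianMetric n M) (f : M → ℝ) (ζ a b : ℝ) : Prop :=
  ∀ x ∈ punctured n f, a < f x → f x < b → ∀ y y', a < f y →
    Chron h f ζ (punctured n f) y y' →
    (∀ s, Chron h f ζ (punctured n f) x s → Chron h f ζ (punctured n f) y' s) →
    Chron h f ζ (punctured n f) y x

theorem exists_pushUp_level [T2Space M] [CompactSpace M] (hf : ContMDiff (𝓡∂ n) 𝓘(ℝ, ℝ) ∞ f)
    (hf01 : ∀ x, f x ∈ Icc (0 : ℝ) 1)
    (hint : ∀ x, 0 < f x → f x < 1 → (𝓡∂ n).IsInteriorPoint x) (hζ : 1 < ζ) {c : ℝ}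
    (hc : c ∈ Ioo (0 : ℝ) 1) (hreg : ∀ p ∈ criticalSet n f, f p ≠ c) :
    ∃ ε > 0, PushUp h f ζ (c - ε) (c + ε) := by
  have hK : IsCompact (f ⁻¹' {c}) := (isClosed_singleton.preimage hf.continuous).isCompact
  obtain ⟨ε, hε, H⟩ := hK.induction_on (p := fun S => ∃ ε > 0, ∀ᶠ x in 𝓝ˢ S,
      ∀ y y', f x - ε < f y → Chron h f ζ (punctured n f) y y' →
      (∀ s, Chron h f ζ (punctured n f) x s → Chron h f ζ (punctured n f) y' s) →
      Chron h f ζ (punctured n f) y x)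
    ⟨1, one_pos, by simp⟩
    (fun S T hST ⟨ε, hε, H⟩ => ⟨ε, hε, nhdsSet_mono hST H⟩)
    (fun S T ⟨ε, hε, H⟩ ⟨ε', hε', H'⟩ => by
      refine ⟨min ε ε', lt_min hε hε', ?_⟩
      rw [nhdsSet_union, Filter.eventually_sup]
      constructor
      · filter_upwards [H] with x hx y y' hy
        exact hx y y' (lt_of_le_of_lt (by gcongr; exact min_le_left _ _) hy)
      · filter_upwards [H'] with x hx y y' hy
        exact hx y y' (lt_of_le_of_lt (by gcongr; exact min_le_right _ _) hy))
    (fun z hz => by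
      have hz' : f z = c := hz
      obtain ⟨ε, hε, H⟩ := exists_pushUp_nhds (h := h) hf hf01 hζ (x₀ := z)
        (fun hcr => hreg z hcr hz') (hint z (hz' ▸ hc.1) (hz' ▸ hc.2))
      exact ⟨_, nhdsWithin_le_nhds (eventually_eventually_nhds.2 H), ε, hε,
        eventually_nhdsSet_iff_forall.2 fun x hx => hx⟩)
  -- As `f` is a closed map, every neighbourhood of the level contains a thin slab around it.
  have hcomap : 𝓝ˢ (f ⁻¹' {c}) = Filter.comap f (𝓝 c) :=
    (hf.continuous.isClosedMap.comap_nhds_eq hf.continuous c).symm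
  rw [hcomap, Filter.eventually_comap] at H
  obtain ⟨δ, hδ, H⟩ := Metric.eventually_nhds_iff.1 H
  -- Half of `ε` on each side of `c` leaves `f x - ε < f y` for all `x`, `y` in the thin slab.
  refine ⟨min δ (ε / 2), by positivity, fun x hx h1 h2 y y' h3 => ?_⟩
  have h4 := min_le_left δ (ε / 2)
  have h5 := min_le_right δ (ε / 2)
  refine H (y := f x) ?_ x rfl y y' (by linarith)
  rw [Real.dist_eq, abs_lt]
  constructor <;> linarith

/-- Only `y` below the overlap and `x` above it need an argument: the relation is pushed up to a
limit point `z₀` on the level `β`, then from there to `x`. -/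
theorem PushUp.union [CompactSpace M] (hf : ContMDiff (𝓡∂ n) 𝓘(ℝ, ℝ) ∞ f)
    (hint : ∀ x, 0 < f x → f x < 1 → (𝓡∂ n).IsInteriorPoint x) (hζ : 1 < ζ)
    {a b a' b' β : ℝ} (h0 : 0 ≤ a) (h1 : b' ≤ 1) (haβ : a' < β) (hβb : β < b)
    (hreg : ∀ p ∈ criticalSet n f, f p ≠ β)
    (hp : PushUp h f ζ a b) (hp' : PushUp h f ζ a' b') : PushUp h f ζ a b' := by
  intro x hx hax hxb y y' hay hyy' hR
  rcases lt_or_ge (f x) b with hxb₁ | hxb₁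
  · exact hp x hx hax hxb₁ y y' hay hyy' hR
  rcases lt_or_ge a' (f y) with hay₁ | hay₁
  · exact hp' x hx (by linarith) hxb y y' hay₁ hyy' hR
  obtain ⟨y₁, hy₁β, hyy₁, hy₁y'⟩ := hyy'.exists_between_left
    (hf.continuous.continuousAt.eventually (gt_mem_nhds (hay₁.trans_lt haβ)))
  have hlev : ∀ s, Chron h f ζ (punctured n f) x s → ∃ z, f z = β ∧
      Chron h f ζ (punctured n f) y₁ z ∧ Chron h f ζ (punctured n f) z s := fun s hs =>
    (hy₁y'.trans (hR s hs)).exists_level hf hy₁β (by linarith [hs.lt hf])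
  choose! z hzβ hyz hzs using hlev
  have hne : (𝓝[{s | Chron h f ζ (punctured n f) x s}] x).NeBot := by
    rw [← mem_closure_iff_nhdsWithin_neBot, mem_closure_iff_nhds]
    intro N hN
    obtain ⟨s, hsN, hs⟩ := exists_chron_mem hf hζ (hx : x ∉ criticalSet n f)
      (hint x (by linarith) (by linarith)) hN (h := h)
    exact ⟨s, hsN, hs⟩
  have hK : IsCompact (f ⁻¹' {β}) := (isClosed_singleton.preimage hf.continuous).isCompact
  obtain ⟨z₀, hz₀, hcl⟩ := hK.exists_mapClusterPt
    (f := 𝓝[{s | Chron h f ζ (punctured n f) x s}] x) (u := z) (by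
      rw [Filter.le_principal_iff, Filter.mem_map]
      filter_upwards [self_mem_nhdsWithin] with s hs
      exact hzβ s hs)
  have hz₀β : f z₀ = β := hz₀
  have hfreq : ∀ N ∈ 𝓝 z₀, ∀ N' ∈ 𝓝 x, ∃ s ∈ N', Chron h f ζ (punctured n f) x s ∧ z s ∈ N := by
    intro N hN N' hN'
    obtain ⟨s, h1, h2, h3⟩ := ((hcl.frequently hN).and_eventually
      (Filter.inter_mem (nhdsWithin_le_nhds hN') self_mem_nhdsWithin)).exists
    exact ⟨s, h2, h3, h1⟩
  -- Any `t` after `z₀` is also after some crossing point `z s`, and `y₁ ≪ z s`; so the lower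
  -- push-up applies to `y ≪ y₁`.
  have hyz₀ : Chron h f ζ (punctured n f) y z₀ := by
    refine hp z₀ (fun hcr => hreg z₀ hcr hz₀β) (by linarith) (by linarith) y y₁ hay hyy₁
      fun t ht => ?_
    obtain ⟨s, -, hs, hst⟩ := hfreq _ (eventually_chron_left hf ht) _ Filter.univ_mem
    exact (hyz s hs).trans hst
  obtain ⟨w', hw'a, hyw', hw'z⟩ := hyz₀.exists_between_right hf
    (hf.continuous.continuousAt.eventually (lt_mem_nhds (hz₀β.symm ▸ haβ)))
  obtain ⟨w, -, hw'w, hwz⟩ := hw'z.exists_between_right hf Filter.univ_mem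
  -- Since `w ≪ z₀`, some `z s` close to `z₀` has `w ≪ z s ≪ s ≪ t`. So `w` precedes all of `I⁺(x)`,
  -- while `w'` lies above `a'`.
  refine hyw'.trans (hp' x hx (by linarith) hxb w' w hw'a hw'w fun t ht => ?_)
  obtain ⟨s, hst, hs, hws⟩ := hfreq _ (eventually_chron_right hf hwz) _ (eventually_chron_left hf ht)
  exact (Relation.TransGen.trans hws (hzs s hs)).trans hst

end

/-! ### Causal continuity of slabs in terms of push-up, and gluing -/

section

variable {n : ℕ} [NeZero n] {M : Type*} [TopologicalSpace M]
  [ChartedSpace (EuclideanHalfSpace n) M] [IsManifold (𝓡∂ n) ∞ M]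
  {h : RiemannianMetric n M} {f : M → ℝ} {ζ : ℝ}

theorem Chron.mono {U V : Set M} (hUV : U ⊆ V) {x y : M} (hxy : Chron h f ζ U x y) :
    Chron h f ζ V x y := by
  refine Relation.TransGen.mono ?_ x y hxy
  rintro x y ⟨γ, hγ, h0, h1⟩
  exact ⟨γ, hγ.mono fun t ht => hUV (hγ t ht).1, h0, h1⟩

theorem chron_slab_iff (hf : ContMDiff (𝓡∂ n) 𝓘(ℝ, ℝ) ∞ f) {a b : ℝ} {x y : M} :
    Chron h f ζ (slab n f a b) x y ↔ Chron h f ζ (punctured n f) x y ∧ a ≤ f x ∧ f y ≤ b := by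
  refine ⟨fun H => ⟨H.mono fun p hp => hp.2, H.left_mem.1.1, H.right_mem.1.2⟩, ?_⟩
  rintro ⟨H, hx, hy⟩
  have key (γ : ℝ → M) (hγ : IsTimelikeCurve h f ζ (punctured n f) γ) (h0 : a ≤ f (γ 0))
      (h1 : f (γ 1) ≤ b) : Chron h f ζ (slab n f a b) (γ 0) (γ 1) := by
    have hm := (hγ.strictMonoOn hf).monotoneOn
    exact .single ⟨γ, hγ.mono fun t ht => ⟨⟨h0.trans (hm (left_mem_Icc.2 zero_le_one) ht ht.1),
      (hm ht (right_mem_Icc.2 zero_le_one) ht.2).trans h1⟩, (hγ t ht).1⟩, rfl, rfl⟩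
  induction H using Relation.TransGen.head_induction_on with
  | single H =>
    obtain ⟨γ, hγ, rfl, rfl⟩ := H
    exact key γ hγ hx hy
  | head H hcy ih =>
    obtain ⟨γ, hγ, rfl, rfl⟩ := H
    have h1 := Chron.lt hf hcy
    have h2 := hγ.strictMonoOn hf (left_mem_Icc.2 zero_le_one) (right_mem_Icc.2 zero_le_one)
      zero_lt_one
    exact (key γ hγ hx (h1.le.trans hy)).trans (ih (hx.trans h2.le))

/-- The fixed vector `e` has `df(e) > 0` throughout a neighbourhood; the value `ζ = 2` used to
obtain it is immaterial. -/
theorem isOpen_punctured (hf : ContMDiff (𝓡∂ n) 𝓘(ℝ, ℝ) ∞ f) (h : RiemannianMetric n M) :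
    IsOpen (punctured n f) := by
  rw [isOpen_iff_mem_nhds]
  intro x hx
  obtain ⟨ρ, K, κ, L, e, cb⟩ := exists_coneBounds h hf one_lt_two (hx : x ∉ criticalSet n f)
  filter_upwards [eventually_mem_coordBall (n := n) x cb.rho_pos] with q hq hcr
  have h1 := ((CoordTimelike.isFutureTimelike_frame hq.1 e).1 (cb.timelike _ hq.2)).2
  rw [differential, hcr] at h1
  exact lt_irrefl _ h1

theorem exists_chron_mem_left (hf : ContMDiff (𝓡∂ n) 𝓘(ℝ, ℝ) ∞ f) (hζ : 1 < ζ) {x : M}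
    (hx : x ∉ criticalSet n f) (hx' : (𝓡∂ n).IsInteriorPoint x) {N : Set M} (hN : N ∈ 𝓝 x) :
    ∃ s ∈ N, Chron h f ζ (punctured n f) s x := by
  obtain ⟨s, hs, hxs⟩ := exists_chron_mem (h := h) (contMDiff_const.sub hf) hζ
    (by rwa [punctured_one_sub hf]) hx' hN
  rw [punctured, punctured_one_sub hf, chron_one_sub hf] at hxs
  exact ⟨s, hs, hxs⟩

/-- A point interior to both the slab and `M` has chronological neighbours on both sides inside the
slab, so its level is strictly between `a` and `b`. -/
theorem mem_spacetimeInterior_slab (hf : ContMDiff (𝓡∂ n) 𝓘(ℝ, ℝ) ∞ f)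
    (h : RiemannianMetric n M) (hint : ∀ x, 0 < f x → f x < 1 → (𝓡∂ n).IsInteriorPoint x)
    {a b : ℝ} (ha : 0 ≤ a) (hb : b ≤ 1) {x : M} : x ∈ spacetimeInterior n (slab n f a b) ↔
      x ∈ punctured n f ∧ a < f x ∧ f x < b := by
  constructor
  · rintro ⟨h1, h2⟩
    have hx := interior_subset h1
    have hN := mem_interior_iff_mem_nhds.1 h1
    obtain ⟨s, hs, hxs⟩ := exists_chron_mem (h := h) hf one_lt_two hx.2 h2 hN
    obtain ⟨p, hp, hpx⟩ := exists_chron_mem_left (h := h) hf one_lt_two hx.2 h2 hN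
    exact ⟨hx.2, hp.1.1.trans_lt (hpx.lt hf), (hxs.lt hf).trans_le hs.1.2⟩
  · rintro ⟨h1, h2, h3⟩
    refine ⟨mem_interior_iff_mem_nhds.2 ?_, hint x (by linarith) (by linarith)⟩
    filter_upwards [(isOpen_punctured hf h).mem_nhds h1,
      hf.continuous.continuousAt.eventually (Icc_mem_nhds h2 h3)] with q h4 h5
    exact ⟨h5, h4⟩

/-- The half of causal continuity which concerns the pasts: `I⁻(x)` is the common past of
`I⁺(x)`. -/
def PastContinuous (h : RiemannianMetric n M) (f : M → ℝ) (ζ : ℝ) (U : Set M) : Prop :=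
  ∀ x ∈ spacetimeInterior n U,
    chronPast h f ζ U x = commonPast h f ζ U (chronFuture h f ζ U x)

/-- The intermediate `y'` in `PushUp` replaces the interior in the definition of the common past:
`I⁻(y')` is an open neighbourhood of `y`, and conversely an interior point has later points that are
still in the common past. -/
theorem pastContinuous_slab_iff (hf : ContMDiff (𝓡∂ n) 𝓘(ℝ, ℝ) ∞ f)
    (hint : ∀ x, 0 < f x → f x < 1 → (𝓡∂ n).IsInteriorPoint x) (hζ : 1 < ζ)
    {a b : ℝ} (ha : 0 ≤ a) (hb : b ≤ 1) :
    PastContinuous h f ζ (slab n f a b) ↔ PushUp h f ζ a b := by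
  constructor
  · intro H x hx hax hxb y y' hay hyy' hR
    -- Needed to place `y` below the level `b`, hence inside the slab.
    have hfy' : f y' ≤ f x := by
      by_contra! hlt
      obtain ⟨s, hs, hxs⟩ := exists_chron_mem (h := h) hf hζ hx
        (hint x (by linarith) (by linarith))
        (hf.continuous.continuousAt.eventually (gt_mem_nhds hlt))
      exact lt_asymm hs ((hR s hxs).lt hf)
    have hy : y ∈ commonPast h f ζ (slab n f a b) (chronFuture h f ζ (slab n f a b) x) := by
      refine ⟨⟨⟨hay.le, by linarith [hyy'.lt hf]⟩, hyy'.left_mem⟩, ?_⟩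
      filter_upwards [nhdsWithin_le_nhds (eventually_chron_left hf hyy'), self_mem_nhdsWithin]
        with q hq hqU
      refine ⟨hqU, fun s hs => (chron_slab_iff hf).2 ⟨hq.trans (hR s ?_), hqU.1.1, ?_⟩⟩
      · exact ((chron_slab_iff hf).1 hs).1
      · exact ((chron_slab_iff hf).1 hs).2.2
    rw [← H x ((mem_spacetimeInterior_slab hf h hint ha hb).2 ⟨hx, hax, hxb⟩)] at hy
    exact ((chron_slab_iff hf).1 hy).1
  · intro H x hx
    obtain ⟨hxp, hax, hxb⟩ := (mem_spacetimeInterior_slab hf h hint ha hb).1 hx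
    have hslab : slab n f a b ∈ 𝓝 x := mem_interior_iff_mem_nhds.1 hx.1
    refine Subset.antisymm (fun y hy => ?_) fun y ⟨hyU, hy⟩ => ?_
    · have hy' := (chron_slab_iff hf).1 hy
      refine ⟨Chron.left_mem hy, ?_⟩
      filter_upwards [nhdsWithin_le_nhds (eventually_chron_left hf hy'.1), self_mem_nhdsWithin]
        with q hq hqU
      exact ⟨hqU, fun s hs => Chron.trans ((chron_slab_iff hf).2 ⟨hq, hqU.1.1, hxb.le⟩) hs⟩
    · obtain ⟨s, hsU, hxs⟩ := exists_chron_mem (h := h) hf hζ hxp hx.2 hslab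
      have hxs' : Chron h f ζ (slab n f a b) x s := (chron_slab_iff hf).2 ⟨hxs, hax.le, hsU.1.2⟩
      obtain ⟨N, hN, hNsub⟩ := mem_nhdsWithin_iff_exists_mem_nhds_inter.1 hy
      have hys : Chron h f ζ (slab n f a b) y s := (hNsub ⟨mem_of_mem_nhds hN, hyU⟩).2 s hxs'
      obtain ⟨y₂, hy₂N, hyy₂, hy₂s⟩ := hys.exists_between_left hN
      -- `y` may lie on the level `a`, where `PushUp` says nothing; `y₁` lies strictly above it.
      obtain ⟨y₁, -, hyy₁, hy₁y₂⟩ := hyy₂.exists_between_left Filter.univ_mem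
      have hfut := (hNsub ⟨hy₂N, hyy₂.right_mem⟩).2
      have hy₁ : Chron h f ζ (punctured n f) y₁ x := by
        refine H x hxp hax hxb y₁ y₂ (hyU.1.1.trans_lt (hyy₁.lt hf))
          ((chron_slab_iff hf).1 hy₁y₂).1 fun t ht => ?_
        -- The common past concerns only futures within the slab; a point `t'` of the slab between
        -- `x` and `t` extends it to every `t` in `I⁺(x)`.
        obtain ⟨t', ht'U, hxt', ht't⟩ := ht.exists_between_left hslab
        exact Chron.trans ((chron_slab_iff hf).1
          (hfut t' ((chron_slab_iff hf).2 ⟨hxt', hax.le, ht'U.1.2⟩))).1 ht't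
      exact (chron_slab_iff hf).2 ⟨Chron.trans ((chron_slab_iff hf).1 hyy₁).1 hy₁,
        hyU.1.1, hxb.le⟩

theorem PushUp.mono {a b a' b' : ℝ} (H : PushUp h f ζ a b) (ha : a ≤ a') (hb : b' ≤ b) :
    PushUp h f ζ a' b' :=
  fun x hx h1 h2 y y' h3 => H x hx (ha.trans_lt h1) (h2.trans_le hb) y y' (ha.trans_lt h3)

theorem exists_regular_level [CompactSpace M] (hf : ContMDiff (𝓡∂ n) 𝓘(ℝ, ℝ) ∞ f)
    (h : RiemannianMetric n M) {c δ : ℝ} (hδ : 0 < δ) (hreg : ∀ p ∈ criticalSet n f, f p ≠ c) :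
    (∃ β ∈ Ioo (c - δ) c, ∀ p ∈ criticalSet n f, f p ≠ β) ∧
      ∃ β ∈ Ioo c (c + δ), ∀ p ∈ criticalSet n f, f p ≠ β := by
  have hcl : IsClosed (criticalSet n f) := by
    rw [← isOpen_compl_iff]; exact isOpen_punctured hf h
  have hcl' : IsClosed (f '' criticalSet n f) := (hcl.isCompact.image hf.continuous).isClosed
  have hmem : (f '' criticalSet n f)ᶜ ∈ 𝓝 c := hcl'.isOpen_compl.mem_nhds (by
    rintro ⟨p, hp, hpc⟩; exact hreg p hp hpc)
  constructor
  · obtain ⟨β, hβ, hβ'⟩ := ((show ∀ᶠ β in 𝓝[<] c, β ∈ (f '' criticalSet n f)ᶜ from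
      nhdsWithin_le_nhds hmem).and (Ioo_mem_nhdsLT (sub_lt_self c hδ))).exists
    exact ⟨β, hβ', fun p hp hpβ => hβ ⟨p, hp, hpβ⟩⟩
  · obtain ⟨β, hβ, hβ'⟩ := ((show ∀ᶠ β in 𝓝[>] c, β ∈ (f '' criticalSet n f)ᶜ from
      nhdsWithin_le_nhds hmem).and (Ioo_mem_nhdsGT (lt_add_of_pos_right c hδ))).exists
    exact ⟨β, hβ', fun p hp hpβ => hβ ⟨p, hp, hpβ⟩⟩

/-- The two slabs only abut at `c`; the thin slab around `c` overlaps both. Each overlap contains a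
regular level because the critical values form a closed set missing `c`. -/
theorem PushUp.glue [T2Space M] [CompactSpace M] (hf : ContMDiff (𝓡∂ n) 𝓘(ℝ, ℝ) ∞ f)
    (hf01 : ∀ x, f x ∈ Icc (0 : ℝ) 1)
    (hint : ∀ x, 0 < f x → f x < 1 → (𝓡∂ n).IsInteriorPoint x) (hζ : 1 < ζ)
    {a c b : ℝ} (ha : 0 ≤ a) (hac : a < c) (hcb : c < b) (hb : b ≤ 1)
    (hreg : ∀ p ∈ criticalSet n f, f p ≠ c)
    (h1 : PushUp h f ζ a c) (h2 : PushUp h f ζ c b) : PushUp h f ζ a b := by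
  obtain ⟨ε, hε, H⟩ := exists_pushUp_level (h := h) hf hf01 hint hζ
    (⟨ha.trans_lt hac, hcb.trans_le hb⟩ : c ∈ Ioo (0 : ℝ) 1) hreg
  set δ := min ε (b - c) with hδdef
  have hδ : 0 < δ := lt_min hε (by linarith)
  have hδε : δ ≤ ε := min_le_left _ _
  have hδb : δ ≤ b - c := min_le_right _ _
  obtain ⟨⟨β, hβ, hβr⟩, β', hβ', hβ'r⟩ := exists_regular_level hf h hδ hreg
  have h3 : PushUp h f ζ a (c + δ) :=
    h1.union hf hint hζ ha (by linarith) hβ.1 hβ.2 hβr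
      (H.mono (by linarith) (by linarith))
  exact h3.union hf hint hζ ha hb hβ'.1 hβ'.2 hβ'r h2

theorem pushUp_iff_forall [T2Space M] [CompactSpace M] (hf : ContMDiff (𝓡∂ n) 𝓘(ℝ, ℝ) ∞ f)
    (hf01 : ∀ x, f x ∈ Icc (0 : ℝ) 1)
    (hint : ∀ x, 0 < f x → f x < 1 → (𝓡∂ n).IsInteriorPoint x) (hζ : 1 < ζ)
    {r : ℕ} {a : Fin (r + 1) → ℝ} (hmono : StrictMono a) (h0 : a 0 = 0) (h1 : a (Fin.last r) = 1)
    (hreg : ∀ k, ∀ p ∈ criticalSet n f, f p ≠ a k) :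
    PushUp h f ζ 0 1 ↔ ∀ k : Fin r, PushUp h f ζ (a k.castSucc) (a k.succ) := by
  have h0a (k) : 0 ≤ a k := h0 ▸ hmono.monotone (Fin.zero_le k)
  have h1a (k) : a k ≤ 1 := h1 ▸ hmono.monotone (Fin.le_last k)
  refine ⟨fun H k => H.mono (h0a _) (h1a _), fun H => ?_⟩
  have key : ∀ k : Fin (r + 1), PushUp h f ζ 0 (a k) := by
    intro k
    induction k using Fin.induction with
    | zero =>
      intro x _ h2 h3
      rw [h0] at h3
      exact absurd h2 (not_lt.2 h3.le)
    | succ k ih =>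
      -- At the first slab there is nothing below to glue to.
      rcases (h0a k.castSucc).eq_or_lt with h2 | h2
      · rw [h2]; exact H k
      · exact ih.glue hf hf01 hint hζ le_rfl h2 (hmono Fin.castSucc_lt_succ) (h1a _)
          (hreg _) (H k)
  rw [← h1]
  exact key _

theorem slab_zero_one (hf01 : ∀ x, f x ∈ Icc (0 : ℝ) 1) : slab n f 0 1 = punctured n f := by
  ext x
  exact ⟨fun H => H.2, fun H => ⟨hf01 x, H⟩⟩

theorem pastContinuous_punctured_iff [T2Space M] [CompactSpace M]
    (hf : ContMDiff (𝓡∂ n) 𝓘(ℝ, ℝ) ∞ f) (hf01 : ∀ x, f x ∈ Icc (0 : ℝ) 1)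
    (hint : ∀ x, 0 < f x → f x < 1 → (𝓡∂ n).IsInteriorPoint x) (hζ : 1 < ζ)
    {r : ℕ} {a : Fin (r + 1) → ℝ} (hmono : StrictMono a) (h0 : a 0 = 0) (h1 : a (Fin.last r) = 1)
    (hreg : ∀ k, ∀ p ∈ criticalSet n f, f p ≠ a k) :
    PastContinuous h f ζ (punctured n f) ↔
      ∀ k : Fin r, PastContinuous h f ζ (slab n f (a k.castSucc) (a k.succ)) := by
  rw [← slab_zero_one hf01, pastContinuous_slab_iff hf hint hζ le_rfl le_rfl,
    pushUp_iff_forall hf hf01 hint hζ hmono h0 h1 hreg]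
  exact forall_congr' fun k => (pastContinuous_slab_iff hf hint hζ
    (h0 ▸ hmono.monotone (Fin.zero_le _)) (h1 ▸ hmono.monotone (Fin.le_last _))).symm

theorem causallyContinuous_iff (hf : ContMDiff (𝓡∂ n) 𝓘(ℝ, ℝ) ∞ f) (U : Set M) :
    CausallyContinuous h f ζ U ↔
      PastContinuous h f ζ U ∧ PastContinuous h (fun x => 1 - f x) ζ U := by
  have hP (x : M) : chronPast h (fun x => 1 - f x) ζ U x = chronFuture h f ζ U x := by
    ext y; exact chron_one_sub hf
  have hF (x : M) : chronFuture h (fun x => 1 - f x) ζ U x = chronPast h f ζ U x := by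
    ext y; exact chron_one_sub hf
  have hC (S : Set M) : commonPast h (fun x => 1 - f x) ζ U S = commonFuture h f ζ U S := by
    simp only [commonPast, commonFuture, chron_one_sub hf]
  simp only [CausallyContinuous, PastContinuous, hP, hF, hC, forall_and]

theorem slab_one_sub (hf : ContMDiff (𝓡∂ n) 𝓘(ℝ, ℝ) ∞ f) (a b : ℝ) :
    slab n (fun x => 1 - f x) (1 - b) (1 - a) = slab n f a b := by
  ext x
  simp only [slab, punctured_one_sub hf, mem_sdiff, mem_preimage, mem_Icc]
  constructor <;> rintro ⟨⟨h1, h2⟩, h3⟩ <;> exact ⟨⟨by linarith, by linarith⟩, h3⟩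

theorem causallyContinuous_punctured_iff [T2Space M] [CompactSpace M]
    (hf : ContMDiff (𝓡∂ n) 𝓘(ℝ, ℝ) ∞ f) (hf01 : ∀ x, f x ∈ Icc (0 : ℝ) 1)
    (hint : ∀ x, 0 < f x → f x < 1 → (𝓡∂ n).IsInteriorPoint x) (hζ : 1 < ζ)
    {r : ℕ} {a : Fin (r + 1) → ℝ} (hmono : StrictMono a) (h0 : a 0 = 0) (h1 : a (Fin.last r) = 1)
    (hreg : ∀ k, ∀ p ∈ criticalSet n f, f p ≠ a k) :
    CausallyContinuous h f ζ (punctured n f) ↔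
      ∀ k : Fin r, CausallyContinuous h f ζ (slab n f (a k.castSucc) (a k.succ)) := by
  -- The future half is the past half for `1 - f`, with the levels reflected and listed in reverse
  -- order.
  have hrev := pastContinuous_punctured_iff (h := h) (ζ := ζ) (f := fun x => 1 - f x)
    (a := fun k => 1 - a k.rev) (contMDiff_const.sub hf)
    (fun x => ⟨by linarith [(hf01 x).2], by linarith [(hf01 x).1]⟩)
    (fun x h1 h2 => hint x (by linarith) (by linarith)) hζ
    (fun i j hij => sub_lt_sub_left (hmono (Fin.rev_lt_rev.2 hij)) 1)
    (by simp [h1]) (by simp [h0])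
    (fun k p hp hpk => hreg k.rev p (by rwa [punctured_one_sub hf] at hp) (by linarith))
  simp only [Fin.rev_castSucc, Fin.rev_succ, slab_one_sub hf, punctured,
    punctured_one_sub hf] at hrev
  simp only [causallyContinuous_iff hf, forall_and]
  refine and_congr (pastContinuous_punctured_iff hf hf01 hint hζ hmono h0 h1 hreg) ?_
  rw [punctured, hrev]
  exact ⟨fun H k => by simpa using H k.rev, fun H k => H k.rev⟩

end

/-! ### Existence of an elementary decomposition -/

section

variable {n : ℕ} [NeZero n] {M : Type*} [TopologicalSpace M]
  [ChartedSpace (EuclideanHalfSpace n) M] [IsManifold (𝓡∂ n) ∞ M] {f : M → ℝ}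

theorem IsMorseFunction.isInteriorPoint_iff (hf : IsMorseFunction n f) {x : M} :
    (𝓡∂ n).IsInteriorPoint x ↔ 0 < f x ∧ f x < 1 := by
  have hb : x ∈ (𝓡∂ n).boundary M ↔ f x = 0 ∨ f x = 1 := by rw [hf.boundary_eq]; rfl
  rw [ModelWithCorners.isInteriorPoint_iff_not_isBoundaryPoint]
  refine (not_congr hb).trans ?_
  have := hf.mem_Icc x
  rw [not_or, this.1.lt_iff_ne', this.2.lt_iff_ne]

/-- The Hessian is the derivative at `p` of the coordinate differential. Being injective in finite
dimension it is bounded below, so the differential has no other zero near `p`. -/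
theorem IsMorseFunction.eventually_mem_punctured (hf : IsMorseFunction n f) {p : M}
    (hp : p ∈ criticalSet n f) : ∀ᶠ q in 𝓝[≠] p, q ∈ punctured n f := by
  set φ := extChartAt (𝓡∂ n) p with hφ
  have hr : range (𝓡∂ n) ∈ 𝓝 (φ p) := range_mem_nhds_isInteriorPoint (hf.critical_interior p hp)
  have ht : φ.target ∈ 𝓝 (φ p) := by
    have := extChartAt_target_mem_nhdsWithin (I := 𝓡∂ n) p
    rwa [nhdsWithin_eq_nhds.2 hr] at this
  have heq : fderiv ℝ (f ∘ φ.symm) =ᶠ[𝓝 (φ p)] coordDiff f p := by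
    filter_upwards [ht, eventually_mem_nhds_iff.2 hr] with u hu hur
    rw [coordDiff_eq_fderivWithin hf.smooth p hu, fderivWithin_of_mem_nhds hur]
  have hd : HasFDerivAt (coordDiff f p) (hessian n f p) (φ p) := by
    have h1 : DifferentiableAt ℝ (coordDiff f p) (φ p) :=
      ((contDiffOn_coordDiff hf.smooth p).contDiffAt ht).differentiableAt (by simp)
    rw [hessian, heq.fderiv_eq]
    exact h1.hasFDerivAt
  have hker : LinearMap.ker (hessian n f p).toLinearMap = ⊥ := by
    refine LinearMap.ker_eq_bot'.2 fun v hv => hf.nondegenerate p hp v fun w => ?_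
    exact congrArg (fun T : Model n →L[ℝ] ℝ => T w) hv
  obtain ⟨K, -, hK⟩ := (hessian n f p).toLinearMap.exists_antilipschitzWith hker
  have hne : ∀ᶠ u in 𝓝[≠] φ p, coordDiff f p u ≠ 0 := hd.eventually_ne ⟨K, hK⟩
  have htend : Filter.Tendsto φ (𝓝[≠] p) (𝓝[≠] φ p) := by
    refine tendsto_nhdsWithin_iff.2 ⟨(continuousAt_extChartAt p).mono_left nhdsWithin_le_nhds, ?_⟩
    filter_upwards [self_mem_nhdsWithin,
      mem_nhdsWithin_of_mem_nhds (extChartAt_source_mem_nhds (I := 𝓡∂ n) p)] with q hq hqs hqp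
    exact hq (φ.injOn hqs (mem_extChartAt_source p) hqp)
  filter_upwards [htend.eventually hne,
    mem_nhdsWithin_of_mem_nhds (extChartAt_source_mem_nhds (I := 𝓡∂ n) p)] with q hq hqs hcrit
  refine hq (ContinuousLinearMap.ext fun w => ?_)
  rw [coordDiff_apply, φ.left_inv hqs, differential, show mfderiv _ _ f q = 0 from hcrit]
  rfl

theorem IsMorseFunction.finite_criticalSet [CompactSpace M] (hf : IsMorseFunction n f)
    (h : RiemannianMetric n M) : (criticalSet n f).Finite := by
  have hc : IsClosed (criticalSet n f) := isOpen_compl_iff.1 (isOpen_punctured hf.smooth h)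
  refine hc.isCompact.finite (isDiscrete_iff_nhdsNE.2 fun p hp => ?_)
  have hd := Filter.disjoint_principal_right.2 (hf.eventually_mem_punctured hp)
  exact hd.eq_bot

theorem exists_separating_levels {r : ℕ} {v : Fin r → ℝ} (hr : 0 < r) (hv : StrictMono v)
    (hv01 : ∀ k, 0 < v k ∧ v k < 1) :
    ∃ a : Fin (r + 1) → ℝ, a 0 = 0 ∧ a (Fin.last r) = 1 ∧
      ∀ k : Fin r, a k.castSucc < v k ∧ v k < a k.succ := by
  -- The values are extended by reflecting the first in `0` and the last in `1`, so that the
  -- midpoints of consecutive terms start at `0`, end at `1`, and separate the values.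
  let V : ℕ → ℝ := fun i =>
    if i = 0 then -v ⟨0, hr⟩ else if hi : i - 1 < r then v ⟨i - 1, hi⟩
      else 2 - v ⟨r - 1, by omega⟩
  have hV0 : V 0 = -v ⟨0, hr⟩ := rfl
  have hV (k : Fin r) : V (k + 1) = v k := by simp [V]
  have hVr : V (r + 1) = 2 - v ⟨r - 1, by omega⟩ := by simp [V]
  have hlt (i : ℕ) (hi : i ≤ r) : V i < V (i + 1) := by
    rcases i with _ | i
    · rw [hV0, hV ⟨0, hr⟩]
      linarith [(hv01 ⟨0, hr⟩).1]
    rw [hV ⟨i, by omega⟩]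
    rcases hi.lt_or_eq with hi | rfl
    · rw [hV ⟨i + 1, hi⟩]
      exact hv (Fin.mk_lt_mk.2 i.lt_succ_self)
    · rw [hVr]
      simp only [Nat.add_sub_cancel]
      linarith [(hv01 ⟨i, by omega⟩).2]
  refine ⟨fun k => (V k + V (k + 1)) / 2, ?_, ?_, fun k => ?_⟩
  · have := hV ⟨0, hr⟩
    simp only [Fin.val_zero] at this ⊢
    rw [hV0, this]; ring
  · have := hV ⟨r - 1, by omega⟩
    simp only [Nat.sub_add_cancel hr] at this
    simp only [Fin.val_last]
    rw [hVr, this]; ring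
  · have h1 := hlt k k.2.le
    have h2 := hlt (k + 1) k.2
    rw [hV] at h1 h2
    simp only [Fin.val_castSucc, Fin.val_succ, hV]
    constructor <;> linarith

theorem IsMorseFunction.exists_isElementaryDecomposition [CompactSpace M]
    (hf : IsMorseFunction n f) (h : RiemannianMetric n M) (hinj : InjOn f (criticalSet n f))
    (hne : (criticalSet n f).Nonempty) :
    ∃ (r : ℕ) (a : Fin (r + 1) → ℝ), IsElementaryDecomposition n f a := by
  have hfin := (hf.finite_criticalSet h).image f
  set S := hfin.toFinset with hS
  let v := S.orderEmbOfFin rfl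
  have hvmem (k) : ∃ p ∈ criticalSet n f, f p = v k :=
    hfin.mem_toFinset.1 (S.orderEmbOfFin_mem rfl k)
  have hvsurj {p : M} (hp : p ∈ criticalSet n f) : ∃ k, v k = f p := by
    have : f p ∈ range v := by
      rw [S.range_orderEmbOfFin rfl, Finset.mem_coe, hS, hfin.mem_toFinset]
      exact mem_image_of_mem f hp
    exact this
  obtain ⟨a, h0, h1, ha⟩ := exists_separating_levels (v := v)
    (Finset.card_pos.2 (hfin.toFinset_nonempty.2 (hne.image f))) v.strictMono fun k => by
      obtain ⟨p, hp, hpk⟩ := hvmem k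
      exact hpk ▸ hf.isInteriorPoint_iff.1 (hf.critical_interior p hp)
  have hmono : StrictMono a := Fin.strictMono_iff_lt_succ.2 fun k => (ha k).1.trans (ha k).2
  refine ⟨_, a, hmono, h0, h1, fun k p hp hpk => ?_, fun k => ?_⟩
  -- A critical value equal to `a k` would place the index `k` strictly between `j` and `j + 1`.
  · obtain ⟨j, hj⟩ := hvsurj hp
    have h2 := ha j
    rw [hj, hpk, hmono.lt_iff_lt, hmono.lt_iff_lt] at h2
    simp only [Fin.lt_def, Fin.val_castSucc, Fin.val_succ] at h2
    omega
  · obtain ⟨p, hp, hpk⟩ := hvmem k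
    refine ⟨p, ⟨hp, hpk ▸ (ha k).1.le, hpk ▸ (ha k).2.le⟩, fun q ⟨hq, hq1, hq2⟩ => hinj hq hp ?_⟩
    obtain ⟨j, hj⟩ := hvsurj hq
    rw [← hj] at hq1 hq2 ⊢
    have h3 := hmono.lt_iff_lt.1 ((ha j).1.trans_le hq2)
    have h4 := hmono.lt_iff_lt.1 (hq1.trans_lt (ha j).2)
    rw [Fin.castSucc_lt_succ_iff] at h3 h4
    rw [hpk, le_antisymm h3 h4]

end

end MorseGeometry

end

theorem mainTheorem4 (n : ℕ) [NeZero n] (M : Type*) [TopologicalSpace M] [T2Space M]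
    [CompactSpace M] [ChartedSpace (EuclideanHalfSpace n) M] [IsManifold (𝓡∂ n) ∞ M]
    (f : M → ℝ) (hf : MorseGeometry.IsMorseFunction n f)
    (hinj : InjOn f (MorseGeometry.criticalSet n f))
    (h : MorseGeometry.RiemannianMetric n M) (ζ : ℝ) (hζ : 1 < ζ) :
    ((MorseGeometry.criticalSet n f).Nonempty →
      ∃ (r : ℕ) (a : Fin (r + 1) → ℝ), MorseGeometry.IsElementaryDecomposition n f a) ∧
    ∀ (r : ℕ) (a : Fin (r + 1) → ℝ), MorseGeometry.IsElementaryDecomposition n f a →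
      (MorseGeometry.CausallyContinuous h f ζ (MorseGeometry.punctured n f) ↔
        ∀ k : Fin r, MorseGeometry.CausallyContinuous h f ζ
          (MorseGeometry.slab n f (a k.castSucc) (a k.succ))) := by
  refine ⟨hf.exists_isElementaryDecomposition h hinj, fun r a ha => ?_⟩
  exact MorseGeometry.causallyContinuous_punctured_iff hf.smooth hf.mem_Icc
    (fun x h0 h1 => hf.isInteriorPoint_iff.2 ⟨h0, h1⟩) hζ ha.strictMono ha.first ha.last ha.regular
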